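/- For each $n$ let $U_1,\dots,U_n$ be independent random variables, uniformly distributed on $[0,1]$, with order statistics $U_{(1)}\le\dots\le U_{(n)}$, and put $U_{(0)}=0$. For $0\le i<j\le n$ with $j-i<n$ let $$M_{i,j}=\frac{j-i-n\,(U_{(j)}-U_{(i)})}{\sqrt{(j-i)\left(1-\frac{j-i}{n}\right)}},$$ and define $$M_n^+=\max_{i,j} M_{i,j},\qquad M_n^-=-\min_{i,j} M_{i,j},\qquad M_n=\max\{M_n^+,M_n^-\},$$ where the maximum and the minimum are over all $0\le i<j\le n$ with $1\le j-i<n$. Then for every $\tau\in\mathbb R$, $$\lim_{n\to\infty}\mathbb P\{M_n^-\le \log n+\tau\}=\exp\bigl(-\exp(-1-\tau)\bigr).$$ The same limit is obtained from single spacings alone: for every $\tau\in\mathbb R$, $$\lim_{n\to\infty}\mathbb P\Bigl\{-\min_{0\le i<n}M_{i,i+1}\le \log n+\tau\Bigr\}=\exp\bigl(-\exp(-1-\tau)\bigr).$$ Moreover, $$\lim_{n\to\infty}\mathbb P\{M_n=M_n^-\}=1.$$ -/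

import Mathlib

open MeasureTheory ProbabilityTheory Filter Topology

noncomputable section

namespace ScanStat

/-- The order statistics `x₍₀₎ ≤ x₍₁₎ ≤ ⋯ ≤ x₍ₙ₊₁₎` of a sample `x` of `n` points of `[0, 1]`:
`orderStat x k` is the `k`-th smallest of the `n` values for `1 ≤ k ≤ n`, with the conventions
`x₍₀₎ = 0` and `x₍ₙ₊₁₎ = 1`. -/
def orderStat {n : ℕ} (x : Fin n → ℝ) (k : ℕ) : ℝ :=
  if h : 1 ≤ k ∧ k ≤ n then x (Tuple.sort x ⟨k - 1, by omega⟩)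
  else if k = 0 then 0 else 1

/-- The normalized quantity
`M_{i,j} = (j - i - n (x₍ⱼ₎ - x₍ᵢ₎)) / √((j - i) (1 - (j - i) / n))`. -/
def M {n : ℕ} (x : Fin n → ℝ) (i j : ℕ) : ℝ :=
  ((j : ℝ) - i - n * (orderStat x j - orderStat x i)) /
    Real.sqrt (((j : ℝ) - i) * (1 - ((j : ℝ) - i) / n))

/-- The statistic `M_n^+(k, l)`: the maximum of `M_{i,j}` over
`0 ≤ i < j ≤ n` with `k ≤ j - i < l`. -/
def MplusRange {n : ℕ} (x : Fin n → ℝ) (k l : ℕ) : ℝ :=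
  sSup ((fun p : ℕ × ℕ => M x p.1 p.2) ''
    {p : ℕ × ℕ | p.1 < p.2 ∧ p.2 ≤ n ∧ k ≤ p.2 - p.1 ∧ p.2 - p.1 < l})

/-- The statistic `M_n^-(k, l)`: minus the minimum of `M_{i,j}` over
`0 ≤ i < j ≤ n` with `k ≤ j - i ≤ l`.  The single pair `(i, j) = (0, n)`, for which the denominator
of `M_{i,j}` vanishes while its numerator `n (1 - x₍ₙ₎)` is nonnegative
(so that `M_{0,n}` is `+∞` and does not affect the minimum), is left out. -/
def MminusRange {n : ℕ} (x : Fin n → ℝ) (k l : ℕ) : ℝ :=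
  -sInf ((fun p : ℕ × ℕ => M x p.1 p.2) ''
    {p : ℕ × ℕ | p.1 < p.2 ∧ p.2 ≤ n ∧ k ≤ p.2 - p.1 ∧ p.2 - p.1 ≤ l ∧ p.2 - p.1 < n})

/-- The one-sided Studentized scan statistic `M_n^+ = M_n^+(1, n)`. -/
def Mplus {n : ℕ} (x : Fin n → ℝ) : ℝ := MplusRange x 1 n

/-- The opposite one-sided Studentized scan statistic `M_n^- = M_n^-(1, n)`. -/
def Mminus {n : ℕ} (x : Fin n → ℝ) : ℝ := MminusRange x 1 n

/-- The two-sided Studentized scan statistic `M_n = max {M_n^+, M_n^-}`. -/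
def Mtwo {n : ℕ} (x : Fin n → ℝ) : ℝ := max (Mplus x) (Mminus x)

end ScanStat

end

/-! The event `-M_{i,i+k} > L` says that the `k`-step gap after the `i`-th order statistic exceeds
`(k + L √(k (1 - k/n))) / n`. With `L = log n + τ` and `k = 1` this threshold `y` satisfies `n y -
log n → 1 + τ`, and the largest of the `n` spacings has a Gumbel limit there. Its law is exact: a
sorted sample is the vector of partial sums of its spacings, so the law is the volume of a cube cut
by a hyperplane, an alternating binomial sum (`measureReal_gapsLe`) whose limit is an exponential
series (`tendsto_alternating_sum`).

All other gaps are negligible. For `k ≥ 2` the denominator is close to `√2` or larger, so Chernoff's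
bound for the count in a window, applied at each of the `n + 1` possible starting points, gives a
power of `n` below `-1` for each bounded `k`; for large `k` the bound `n e^{-3L}` survives summation
over all `k` (`tendsto_largeExcess`). Short gaps obey the same bound `n e^{-3L}` unless almost all
points lie inside the gap; then only the two ends of the interval matter (`gapSmall_ends`), and
`M_n^+` stays below `log n + τ` with high probability (`tendsto_smallExcess`).

If `M_n ≠ M_n^-`, then `M_n^+ > M_n^-`, so either `M_n^+ > log n + τ` or `M_n^- ≤ log n + τ`. The
first probability vanishes for every `τ`, and the limit of the second tends to `0` as `τ → -∞`. -/

namespace ScanStat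

/-! ### Order statistics, gaps and window counts -/

/-- The number of points of the sample `x` that lie in `s`. -/
noncomputable def countIn {n : ℕ} (s : Set ℝ) (x : Fin n → ℝ) : ℕ :=
  ∑ b, s.indicator (fun _ => 1) (x b)

lemma countIn_eq_card {n : ℕ} (s : Set ℝ) [DecidablePred (· ∈ s)] (x : Fin n → ℝ) :
    countIn s x = (Finset.univ.filter fun b => x b ∈ s).card := by
  rw [countIn, Finset.card_filter]
  exact Finset.sum_congr rfl fun b _ => by simp [Set.indicator_apply]

lemma orderStat_zero {n : ℕ} (x : Fin n → ℝ) : orderStat x 0 = 0 := by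
  simp [orderStat]

lemma orderStat_of_mem {n : ℕ} (x : Fin n → ℝ) {k : ℕ} (h : 1 ≤ k ∧ k ≤ n) :
    orderStat x k = x (Tuple.sort x ⟨k - 1, by omega⟩) := by
  rw [orderStat, dif_pos h]

lemma card_filter_comp_sort {n : ℕ} (x : Fin n → ℝ) (p : ℝ → Prop) [DecidablePred p] :
    (Finset.univ.filter fun b => p (x (Tuple.sort x b))).card =
      (Finset.univ.filter fun b => p (x b)).card :=
  Finset.card_equiv (Tuple.sort x) (by simp)

/-- A lower set contains the `k`-th order statistic iff it contains at least `k` sample points. -/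
lemma orderStat_mem_iff {n : ℕ} (x : Fin n → ℝ) {k : ℕ} (hk : 1 ≤ k) (hkn : k ≤ n)
    (p : ℝ → Prop) [DecidablePred p] (hp : ∀ a b, a ≤ b → p b → p a) :
    p (orderStat x k) ↔ k ≤ (Finset.univ.filter fun b => p (x b)).card := by
  have hmono : Monotone (x ∘ Tuple.sort x) := Tuple.monotone_sort x
  rw [orderStat_of_mem x ⟨hk, hkn⟩, ← card_filter_comp_sort]
  constructor
  · intro h
    have hsub : Finset.Iic (⟨k - 1, by omega⟩ : Fin n) ⊆
        Finset.univ.filter fun b => p (x (Tuple.sort x b)) := by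
      intro b hb
      rw [Finset.mem_Iic] at hb
      simp only [Finset.mem_filter, Finset.mem_univ, true_and]
      exact hp _ _ (hmono hb) h
    have := Finset.card_le_card hsub
    rw [Fin.card_Iic] at this
    simp only at this
    omega
  · intro h
    by_contra hc
    have hsub : (Finset.univ.filter fun b => p (x (Tuple.sort x b))) ⊆
        Finset.Iio (⟨k - 1, by omega⟩ : Fin n) := by
      intro b hb
      simp only [Finset.mem_filter, Finset.mem_univ, true_and] at hb
      rw [Finset.mem_Iio]
      by_contra hlt
      exact hc (hp _ _ (hmono (not_lt.mp hlt)) hb)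
    have := Finset.card_le_card hsub
    rw [Fin.card_Iio] at this
    simp only at this
    omega

lemma orderStat_le_iff {n : ℕ} (x : Fin n → ℝ) {k : ℕ} (hk : 1 ≤ k) (hkn : k ≤ n) (c : ℝ) :
    orderStat x k ≤ c ↔ k ≤ (Finset.univ.filter fun b => x b ≤ c).card :=
  orderStat_mem_iff x hk hkn (fun t => t ≤ c) fun _ _ h h' => h.trans h'

lemma orderStat_lt_iff {n : ℕ} (x : Fin n → ℝ) {k : ℕ} (hk : 1 ≤ k) (hkn : k ≤ n) (c : ℝ) :
    orderStat x k < c ↔ k ≤ (Finset.univ.filter fun b => x b < c).card :=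
  orderStat_mem_iff x hk hkn (fun t => t < c) fun _ _ h h' => h.trans_lt h'

lemma orderStat_eq_apply {n : ℕ} (x : Fin n → ℝ) {k : ℕ} (hk : 1 ≤ k) (hkn : k ≤ n) :
    ∃ a, orderStat x k = x a := ⟨_, orderStat_of_mem x ⟨hk, hkn⟩⟩

lemma orderStat_mem_Icc {n : ℕ} {x : Fin n → ℝ} (hx : ∀ b, x b ∈ Set.Icc (0 : ℝ) 1) (k : ℕ) :
    orderStat x k ∈ Set.Icc (0 : ℝ) 1 := by
  rw [orderStat]
  split_ifs with h h'
  · exact hx _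
  · simp
  · simp

lemma orderStat_le_orderStat {n : ℕ} {x : Fin n → ℝ} (hx : ∀ b, x b ∈ Set.Icc (0 : ℝ) 1)
    {i j : ℕ} (hij : i ≤ j) (hj : j ≤ n) : orderStat x i ≤ orderStat x j := by
  rcases Nat.eq_zero_or_pos i with rfl | hi
  · rw [orderStat_zero]
    exact (orderStat_mem_Icc hx j).1
  · rw [orderStat_le_iff x hi (hij.trans hj)]
    exact hij.trans ((orderStat_le_iff x (hi.trans_le hij) hj _).1 le_rfl)

lemma measurable_countIn {n : ℕ} {s : Set ℝ} (hs : MeasurableSet s) :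
    Measurable fun x : Fin n → ℝ => countIn s x :=
  Finset.measurable_sum _ fun b _ => (measurable_const.indicator hs).comp (measurable_pi_apply b)

lemma measurable_orderStat {n : ℕ} (k : ℕ) :
    Measurable fun x : Fin n → ℝ => orderStat x k := by
  by_cases h : 1 ≤ k ∧ k ≤ n
  · refine measurable_of_Iic fun c => ?_
    have : (fun x : Fin n → ℝ => orderStat x k) ⁻¹' Set.Iic c =
        (fun x : Fin n → ℝ => countIn (Set.Iic c) x) ⁻¹' Set.Ici k := by
      ext x
      simp [orderStat_le_iff x h.1 h.2, countIn_eq_card]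
    rw [this]
    exact measurable_countIn measurableSet_Iic measurableSet_Ici
  · simp only [orderStat, dif_neg h]
    exact measurable_const

/-- A long gap after the `i`-th order statistic leaves few sample points in the window behind it. -/
lemma card_window_lt_of_lt_sub {n : ℕ} {x : Fin n → ℝ}
    {i j : ℕ} (hij : i < j) (hj : j ≤ n) {y : ℝ} (hy : 0 ≤ y)
    (h : y < orderStat x j - orderStat x i) :
    countIn (Set.Ioc (orderStat x i) (orderStat x i + y)) x < j - i := by
  rw [countIn_eq_card]
  set s := orderStat x i with hs
  have h1 : (Finset.univ.filter fun b => x b ≤ s + y).card < j := by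
    rw [← not_le, ← orderStat_le_iff x (by omega) hj]
    linarith
  have h2 : i ≤ (Finset.univ.filter fun b => x b ≤ s).card := by
    rcases Nat.eq_zero_or_pos i with rfl | hi
    · exact Nat.zero_le _
    · exact (orderStat_le_iff x hi (by omega) s).1 hs.ge
  have h3 : (Finset.univ.filter fun b => x b ≤ s).card +
      (Finset.univ.filter fun b => x b ∈ Set.Ioc s (s + y)).card =
      (Finset.univ.filter fun b => x b ≤ s + y).card := by
    rw [← Finset.card_union_of_disjoint]
    · congr 1
      ext b
      simp only [Finset.mem_union, Finset.mem_filter, Finset.mem_univ, true_and, Set.mem_Ioc]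
      constructor
      · rintro (h | h) <;> linarith [h]
      · intro h
        rcases le_or_gt (x b) s with h' | h'
        · exact Or.inl h'
        · exact Or.inr ⟨h', h⟩
    · rw [Finset.disjoint_filter]
      intro b _ hb hb'
      exact absurd hb'.1 (not_lt.2 hb)
  omega

/-- A short gap after the `i`-th order statistic puts many sample points in the window behind
it. -/
lemma le_card_window_of_sub_lt {n : ℕ} {x : Fin n → ℝ}
    {i j : ℕ} (hi : 1 ≤ i) (hij : i < j) (hj : j ≤ n) {y : ℝ}
    (h : orderStat x j - orderStat x i < y) :
    j - i + 1 ≤ countIn (Set.Icc (orderStat x i) (orderStat x i + y)) x := by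
  rw [countIn_eq_card]
  set s := orderStat x i with hs
  have h1 : j ≤ (Finset.univ.filter fun b => x b ≤ s + y).card := by
    rw [← orderStat_le_iff x (by omega) hj]
    linarith
  have h2 : (Finset.univ.filter fun b => x b < s).card < i := by
    rw [← not_le, ← orderStat_lt_iff x hi (by omega)]
    exact hs.ge.not_gt
  have h3 : (Finset.univ.filter fun b => x b ≤ s + y).card ≤
      (Finset.univ.filter fun b => x b < s).card +
      (Finset.univ.filter fun b => x b ∈ Set.Icc s (s + y)).card := by
    refine le_trans (Finset.card_le_card ?_) (Finset.card_union_le _ _)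
    intro b
    simp only [Finset.mem_union, Finset.mem_filter, Finset.mem_univ, true_and, Set.mem_Icc]
    intro h
    rcases lt_or_ge (x b) s with h' | h'
    · exact Or.inl h'
    · exact Or.inr ⟨h', h⟩
  omega

/-! ### Chernoff bounds for window counts -/

/-- The uniform distribution on `[0, 1]`. -/
noncomputable def unif : Measure ℝ := volume.restrict (Set.Icc 0 1)

instance : IsProbabilityMeasure unif := ⟨by simp [unif]⟩

/-- The law of a sample of `n` independent uniform points of `[0, 1]`. -/
noncomputable def unifSample (n : ℕ) : Measure (Fin n → ℝ) := Measure.pi fun _ => unif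

instance (n : ℕ) : IsProbabilityMeasure (unifSample n) := by
  unfold unifSample; infer_instance

lemma integral_exp_indicator {I : Set ℝ} (hI : MeasurableSet I) (t : ℝ) :
    ∫ u, Real.exp (t * (I.indicator (fun _ => (1 : ℕ)) u : ℕ)) ∂unif =
      1 + unif.real I * (Real.exp t - 1) := by
  have : ∀ u, Real.exp (t * (I.indicator (fun _ => (1 : ℕ)) u : ℕ)) =
      1 + I.indicator (fun _ => Real.exp t - 1) u := by
    intro u
    by_cases hu : u ∈ I <;> simp [hu]
  simp_rw [this]
  rw [integral_add (integrable_const _) ((integrable_const _).indicator hI),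
    integral_indicator hI]
  simp

lemma integral_exp_countIn {n : ℕ} {I : Set ℝ} (hI : MeasurableSet I) (t : ℝ) :
    ∫ x : Fin n → ℝ, Real.exp (t * countIn I x) ∂unifSample n =
      (1 + unif.real I * (Real.exp t - 1)) ^ n := by
  have : ∀ x : Fin n → ℝ, Real.exp (t * countIn I x) =
      ∏ b, Real.exp (t * (I.indicator (fun _ => (1 : ℕ)) (x b) : ℕ)) := by
    intro x
    rw [← Real.exp_sum, countIn, Nat.cast_sum, Finset.mul_sum]
  simp_rw [this]
  rw [unifSample, integral_fintype_prod_eq_pow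
    (fun u => Real.exp (t * (I.indicator (fun _ => (1 : ℕ)) u : ℕ))), integral_exp_indicator hI,
    Fintype.card_fin]

lemma countIn_le {n : ℕ} (I : Set ℝ) (x : Fin n → ℝ) : countIn I x ≤ n := by
  classical
  rw [countIn_eq_card]
  simpa using Finset.card_filter_le (Finset.univ : Finset (Fin n)) fun b => x b ∈ I

lemma countIn_add_compl {n : ℕ} (I : Set ℝ) (x : Fin n → ℝ) :
    countIn I x + countIn Iᶜ x = n := by
  rw [countIn, countIn, ← Finset.sum_add_distrib]
  have : ∀ b, I.indicator (fun _ => 1) (x b) + Iᶜ.indicator (fun _ => 1) (x b) = 1 := by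
    intro b
    by_cases hb : x b ∈ I <;> simp [hb]
  simp [this]

/-- Chernoff's bound for the number of sample points in a set. -/
lemma chernoff_countIn {n : ℕ} {I : Set ℝ} (hI : MeasurableSet I) (t a : ℝ) :
    (unifSample n).real {x | a ≤ t * countIn I x} ≤
      Real.exp (-a + n * unif.real I * (Real.exp t - 1)) := by
  have hmeas : Measurable fun x : Fin n → ℝ => Real.exp (t * countIn I x) :=
    Real.measurable_exp.comp
      ((measurable_from_top.comp (measurable_countIn hI)).const_mul t)
  have hint : Integrable (fun x : Fin n → ℝ => Real.exp (t * countIn I x)) (unifSample n) := by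
    refine Integrable.of_bound hmeas.aestronglyMeasurable (Real.exp (|t| * n)) (ae_of_all _ ?_)
    intro x
    rw [Real.norm_eq_abs, Real.abs_exp]
    refine Real.exp_le_exp.2 ?_
    have : (countIn I x : ℝ) ≤ n := by exact_mod_cast countIn_le I x
    exact mul_le_mul (le_abs_self t) this (Nat.cast_nonneg _) (abs_nonneg t)
  have hM := mul_meas_ge_le_integral_of_nonneg
    (μ := unifSample n) (f := fun x : Fin n → ℝ => Real.exp (t * countIn I x))
    (ae_of_all _ fun x => (Real.exp_pos _).le) hint (Real.exp a)
  rw [integral_exp_countIn hI] at hM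
  have hset : {x : Fin n → ℝ | Real.exp a ≤ Real.exp (t * countIn I x)} =
      {x | a ≤ t * countIn I x} := by
    ext x; simp
  rw [hset] at hM
  have hp : 0 ≤ 1 + unif.real I * (Real.exp t - 1) := by
    have h1 : unif.real I ≤ 1 := measureReal_le_one
    have h0 : 0 ≤ unif.real I := measureReal_nonneg
    nlinarith [Real.exp_pos t]
  -- `1 + x ≤ e^x` replaces the binomial moment generating function by the Poisson one with the same
  -- mean.
  have hpow : (1 + unif.real I * (Real.exp t - 1)) ^ n ≤
      Real.exp (n * unif.real I * (Real.exp t - 1)) := by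
    rw [mul_assoc, Real.exp_nat_mul]
    refine pow_le_pow_left₀ hp ?_ n
    rw [add_comm]
    exact Real.add_one_le_exp _
  rw [Real.exp_add, Real.exp_neg, ← div_eq_inv_mul, le_div_iff₀ (Real.exp_pos a), mul_comm]
  exact hM.trans hpow

lemma countIn_le_tail {n : ℕ} {I : Set ℝ} (hI : MeasurableSet I) (m : ℕ) {θ p : ℝ} (hθ : 0 ≤ θ)
    (hp : p ≤ unif.real I) :
    (unifSample n).real {x | countIn I x ≤ m} ≤
      Real.exp (θ * m - n * p * (1 - Real.exp (-θ))) := by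
  refine (measureReal_mono ?_).trans ((chernoff_countIn hI (-θ) (-(θ * m))).trans ?_)
  · intro x hx
    have : (countIn I x : ℝ) ≤ m := by exact_mod_cast hx
    simp only [Set.mem_ofPred_eq]
    nlinarith
  · refine Real.exp_le_exp.2 ?_
    have h1 : 0 ≤ 1 - Real.exp (-θ) := by
      have := Real.exp_le_one_iff.2 (neg_nonpos.2 hθ)
      linarith
    have : (n : ℝ) * p * (1 - Real.exp (-θ)) ≤ n * unif.real I * (1 - Real.exp (-θ)) := by
      gcongr
    linarith

lemma le_countIn_tail {n : ℕ} {I : Set ℝ} (hI : MeasurableSet I) (m : ℕ) {θ p : ℝ} (hθ : 0 ≤ θ)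
    (hp : unif.real I ≤ p) :
    (unifSample n).real {x | m ≤ countIn I x} ≤
      Real.exp (-(θ * m) + n * p * (Real.exp θ - 1)) := by
  refine (measureReal_mono ?_).trans ((chernoff_countIn hI θ (θ * m)).trans ?_)
  · intro x hx
    have : (m : ℝ) ≤ countIn I x := by exact_mod_cast hx
    simp only [Set.mem_ofPred_eq]
    nlinarith
  · refine Real.exp_le_exp.2 ?_
    have h1 : 0 ≤ Real.exp θ - 1 := by
      have := Real.one_le_exp hθ
      linarith
    have : (n : ℝ) * unif.real I * (Real.exp θ - 1) ≤ n * p * (Real.exp θ - 1) := by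
      gcongr
    linarith

/-- The Poisson-type bound treats the mean `n p` as the variance, which is wasteful for `p` near 1.
Counting the points outside the set replaces `n p` by `n (1 - p)`. -/
lemma countIn_le_tail_compl {n : ℕ} {I : Set ℝ} (hI : MeasurableSet I) (m l : ℕ) {θ p : ℝ}
    (hθ : 0 ≤ θ) (hp : p ≤ unif.real I) (hl : l + m ≤ n) :
    (unifSample n).real {x | countIn I x ≤ m} ≤
      Real.exp (-(θ * l) + n * (1 - p) * (Real.exp θ - 1)) := by
  refine (measureReal_mono ?_).trans (le_countIn_tail hI.compl l hθ (p := 1 - p) ?_)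
  · intro x hx
    have := countIn_add_compl I x
    simp only [Set.mem_ofPred_eq] at hx ⊢
    omega
  · rw [probReal_compl_eq_one_sub hI]
    linarith

lemma le_countIn_tail_compl {n : ℕ} {I : Set ℝ} (hI : MeasurableSet I) (m l : ℕ) {θ p : ℝ}
    (hθ : 0 ≤ θ) (hp : unif.real I ≤ p) (hl : n ≤ l + m) :
    (unifSample n).real {x | m ≤ countIn I x} ≤
      Real.exp (θ * l - n * (1 - p) * (1 - Real.exp (-θ))) := by
  refine (measureReal_mono ?_).trans (countIn_le_tail hI.compl l hθ (p := 1 - p) ?_)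
  · intro x hx
    have := countIn_add_compl I x
    simp only [Set.mem_ofPred_eq] at hx ⊢
    omega
  · rw [probReal_compl_eq_one_sub hI]
    linarith

/-! ### From windows at a sample point to gaps -/

lemma countIn_succAbove {n : ℕ} (a : Fin (n + 1)) (I : Set ℝ) (x : Fin (n + 1) → ℝ) :
    countIn I x = I.indicator (fun _ => 1) (x a) + countIn I (fun b => x (a.succAbove b)) := by
  rw [countIn, Fin.sum_univ_succAbove _ a, countIn]

/-- Conditioning on one sample point `x a`: a bound for the number of the other points in a window
that depends on `x a` carries over to the joint law. -/
lemma measureReal_window_le {n : ℕ} (a : Fin (n + 1)) {T : Set ℝ} (hT : MeasurableSet T)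
    {V : Set (ℝ × ℝ)} (hV : MeasurableSet V) (K : Set ℕ) {B : ℝ} (hB : 0 ≤ B)
    (h : ∀ s ∈ T, (unifSample n).real {x | countIn (Prod.mk s ⁻¹' V) x ∈ K} ≤ B) :
    (unifSample (n + 1)).real {x | x a ∈ T ∧
      countIn (Prod.mk (x a) ⁻¹' V) (fun b => x (a.succAbove b)) ∈ K} ≤ B := by
  set S : Set (ℝ × (Fin n → ℝ)) :=
    {q | q.1 ∈ T ∧ countIn (Prod.mk q.1 ⁻¹' V) q.2 ∈ K} with hS
  have hcount : Measurable fun q : ℝ × (Fin n → ℝ) => countIn (Prod.mk q.1 ⁻¹' V) q.2 := by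
    refine Finset.measurable_sum _ fun b _ => ?_
    exact (measurable_const.indicator hV : Measurable (V.indicator fun _ => (1 : ℕ))).comp
      (measurable_fst.prodMk ((measurable_pi_apply b).comp measurable_snd))
  have hSm : MeasurableSet S := (measurable_fst hT).inter (hcount (MeasurableSet.of_discrete))
  have hmp := measurePreserving_piFinSuccAbove (fun _ : Fin (n + 1) => unif) a
  have h1 : unifSample (n + 1) {x | x a ∈ T ∧
      countIn (Prod.mk (x a) ⁻¹' V) (fun b => x (a.succAbove b)) ∈ K} =
      (unif.prod (unifSample n)) S := hmp.measure_preimage hSm.nullMeasurableSet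
  rw [measureReal_def, h1, Measure.prod_apply hSm]
  refine ENNReal.toReal_le_of_le_ofReal hB ?_
  calc ∫⁻ s, unifSample n (Prod.mk s ⁻¹' S) ∂unif ≤ ∫⁻ _, ENNReal.ofReal B ∂unif := by
        refine lintegral_mono fun s => ?_
        by_cases hs : s ∈ T
        · have : Prod.mk s ⁻¹' S = {x | countIn (Prod.mk s ⁻¹' V) x ∈ K} := by
            ext x; simp [hS, hs]
          rw [this, ← ofReal_measureReal]
          exact ENNReal.ofReal_le_ofReal (h s hs)
        · have : Prod.mk s ⁻¹' S = ∅ := by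
            ext x; simp [hS, hs]
          simp [this]
    _ = ENNReal.ofReal B := by simp

/-- Samples in the unit cube with a `k`-step gap larger than `y`. -/
def gapLarge (n k : ℕ) (y : ℝ) : Set (Fin n → ℝ) :=
  {x | (∀ b, x b ∈ Set.Icc (0 : ℝ) 1) ∧ ∃ i, i + k ≤ n ∧ y < orderStat x (i + k) - orderStat x i}

/-- Samples in the unit cube with a `k`-step gap smaller than `y`. -/
def gapSmall (n k : ℕ) (y : ℝ) : Set (Fin n → ℝ) :=
  {x | (∀ b, x b ∈ Set.Icc (0 : ℝ) 1) ∧ ∃ i, i + k ≤ n ∧ orderStat x (i + k) - orderStat x i < y}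

/-- `S₀` is for the gap starting at the origin, which is not a sample point, and `S a` for a gap
starting at the point `x a`. -/
lemma measureReal_union_window_le {n : ℕ} {E S₀ : Set (Fin (n + 1) → ℝ)}
    {S : Fin (n + 1) → Set (Fin (n + 1) → ℝ)} {B : ℝ} (hE : E ⊆ S₀ ∪ ⋃ a, S a)
    (h₀ : (unifSample (n + 1)).real S₀ ≤ B) (h : ∀ a, (unifSample (n + 1)).real (S a) ≤ B) :
    (unifSample (n + 1)).real E ≤ (n + 2) * B := by
  calc (unifSample (n + 1)).real E ≤ (unifSample (n + 1)).real (S₀ ∪ ⋃ a, S a) :=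
        measureReal_mono hE
    _ ≤ (unifSample (n + 1)).real S₀ + (unifSample (n + 1)).real (⋃ a, S a) :=
        measureReal_union_le _ _
    _ ≤ B + ∑ a, (unifSample (n + 1)).real (S a) :=
        add_le_add h₀ (measureReal_iUnion_fintype_le _)
    _ ≤ B + ∑ _a : Fin (n + 1), B := by gcongr with a; exact h a
    _ = (n + 2) * B := by simp; ring

lemma gapLarge_eq_empty {n k : ℕ} {y : ℝ} (hy : 1 ≤ y) : gapLarge n k y = ∅ := by
  ext x
  simp only [gapLarge, Set.mem_ofPred_eq, Set.mem_empty_iff_false, iff_false]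
  rintro ⟨hx, i, -, hi⟩
  have h1 := (orderStat_mem_Icc hx (i + k)).2
  have h2 := (orderStat_mem_Icc hx i).1
  linarith

lemma gapSmall_eq_empty {n k : ℕ} {y : ℝ} (hy : y ≤ 0) : gapSmall n k y = ∅ := by
  ext x
  simp only [gapSmall, Set.mem_ofPred_eq, Set.mem_empty_iff_false, iff_false]
  rintro ⟨hx, i, hk, hi⟩
  have h1 := orderStat_le_orderStat hx (Nat.le_add_right i k) hk
  linarith

lemma unif_real_Ioc {s y : ℝ} (hs : 0 ≤ s) (hy : 0 ≤ y) (h : s + y ≤ 1) :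
    unif.real (Set.Ioc s (s + y)) = y := by
  rw [unif, measureReal_restrict_apply measurableSet_Ioc, Set.inter_eq_left.2]
  · simp [hy]
  · intro u hu
    exact ⟨by linarith [hu.1], by linarith [hu.2]⟩

lemma unif_real_Icc_le {s y : ℝ} (hy : 0 ≤ y) :
    unif.real (Set.Icc s (s + y)) ≤ y := by
  rw [unif, measureReal_restrict_apply measurableSet_Icc]
  refine (measureReal_mono Set.inter_subset_left (by simp)).trans ?_
  simp [hy]

/-- A bound for long gaps, from bounds for windows of length `y` in the unit interval. -/
lemma measureReal_gapLarge_le {n k : ℕ} (hk : 1 ≤ k) {y B : ℝ} (hy : 0 ≤ y) (hB : 0 ≤ B)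
    (h₀ : ∀ I, MeasurableSet I → unif.real I = y →
      (unifSample (n + 1)).real {x | countIn I x ≤ k - 1} ≤ B)
    (h : ∀ I, MeasurableSet I → unif.real I = y →
      (unifSample n).real {x | countIn I x ≤ k - 1} ≤ B) :
    (unifSample (n + 1)).real (gapLarge (n + 1) k y) ≤ (n + 2) * B := by
  rcases le_or_gt 1 y with hy1 | hy1
  · rw [gapLarge_eq_empty hy1]
    simp only [measureReal_empty]
    positivity
  set V : Set (ℝ × ℝ) := {q | q.1 < q.2 ∧ q.2 ≤ q.1 + y} with hVdef
  have hV : MeasurableSet V := (measurableSet_lt measurable_fst measurable_snd).inter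
    (measurableSet_le measurable_snd (measurable_fst.add_const y))
  have hsec : ∀ s, Prod.mk s ⁻¹' V = Set.Ioc s (s + y) := fun s => by ext; simp [V]
  refine measureReal_union_window_le (S₀ := {x | countIn (Set.Ioc 0 (0 + y)) x ≤ k - 1})
    (S := fun a => {x | x a ∈ Set.Icc 0 (1 - y) ∧
      countIn (Prod.mk (x a) ⁻¹' V) (fun b => x (a.succAbove b)) ∈ Set.Iic (k - 1)}) ?_ ?_ ?_
  · rintro x ⟨hx, i, hik, hgap⟩
    have hw := card_window_lt_of_lt_sub (by omega : i < i + k) hik hy hgap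
    have h1 := (orderStat_mem_Icc hx (i + k)).2
    have h2 := (orderStat_mem_Icc hx i).1
    rcases Nat.eq_zero_or_pos i with rfl | hi
    · left
      rw [orderStat_zero] at hw
      simp only [Set.mem_ofPred_eq]
      omega
    · right
      obtain ⟨a, ha⟩ := orderStat_eq_apply x hi (by omega)
      refine Set.mem_iUnion.2 ⟨a, ⟨by linarith, by linarith⟩, ?_⟩
      rw [ha, countIn_succAbove a] at hw
      rw [hsec, Set.mem_Iic]
      omega
  · exact h₀ _ measurableSet_Ioc (unif_real_Ioc le_rfl hy (by linarith))
  · intro a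
    refine measureReal_window_le a measurableSet_Icc hV _ hB fun s hs => ?_
    rw [hsec]
    exact h _ measurableSet_Ioc (unif_real_Ioc hs.1 hy (by linarith [hs.2]))

/-- The closed window from `x a` holds `k + 1` points including `x a` itself, so `k` of the others.
A window that leaves the unit interval only has smaller measure, hence no restriction on the start.
-/
lemma measureReal_gapSmall_le {n k : ℕ} (hk : 1 ≤ k) {y B : ℝ} (hB : 0 ≤ B)
    (h₀ : ∀ I, MeasurableSet I → unif.real I ≤ y →
      (unifSample (n + 1)).real {x | k ≤ countIn I x} ≤ B)
    (h : ∀ I, MeasurableSet I → unif.real I ≤ y →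
      (unifSample n).real {x | k ≤ countIn I x} ≤ B) :
    (unifSample (n + 1)).real (gapSmall (n + 1) k y) ≤ (n + 2) * B := by
  rcases le_or_gt y 0 with hy | hy
  · rw [gapSmall_eq_empty hy]
    simp only [measureReal_empty]
    positivity
  set V : Set (ℝ × ℝ) := {q | q.1 ≤ q.2 ∧ q.2 ≤ q.1 + y} with hVdef
  have hV : MeasurableSet V := (measurableSet_le measurable_fst measurable_snd).inter
    (measurableSet_le measurable_snd (measurable_fst.add_const y))
  have hsec : ∀ s, Prod.mk s ⁻¹' V = Set.Icc s (s + y) := fun s => by ext; simp [V]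
  refine measureReal_union_window_le (S₀ := {x | k ≤ countIn (Set.Icc 0 (0 + y)) x})
    (S := fun a => {x | x a ∈ Set.univ ∧
      countIn (Prod.mk (x a) ⁻¹' V) (fun b => x (a.succAbove b)) ∈ Set.Ici k}) ?_ ?_ ?_
  · rintro x ⟨hx, i, hik, hgap⟩
    rcases Nat.eq_zero_or_pos i with rfl | hi
    · left
      rw [orderStat_zero, sub_zero, zero_add] at hgap
      rw [zero_add] at hik
      have := (orderStat_le_iff x hk hik y).1 hgap.le
      simp only [Set.mem_ofPred_eq]
      rw [countIn_eq_card]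
      refine this.trans (Finset.card_le_card ?_)
      intro b
      simp only [Finset.mem_filter, Finset.mem_univ, true_and, Set.mem_Icc, zero_add]
      exact fun hb => ⟨(hx b).1, hb⟩
    · right
      have hw := le_card_window_of_sub_lt hi (by omega : i < i + k) hik hgap
      obtain ⟨a, ha⟩ := orderStat_eq_apply x hi (by omega)
      refine Set.mem_iUnion.2 ⟨a, Set.mem_univ _, ?_⟩
      have hmem : x a ∈ Set.Icc (x a) (x a + y) := ⟨le_rfl, by linarith⟩
      rw [ha, countIn_succAbove a, Set.indicator_of_mem hmem] at hw
      rw [hsec, Set.mem_Ici]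
      omega
  · exact h₀ _ measurableSet_Icc (unif_real_Icc_le hy.le)
  · intro a
    refine measureReal_window_le a MeasurableSet.univ hV _ hB fun s _ => ?_
    rw [hsec]
    exact h _ measurableSet_Icc (unif_real_Icc_le hy.le)

/-- Each kind of gap gets two bounds, from the points inside the window or from those outside. The
choice between them will depend on which of `k` and its complement is the smaller; `θ` is tuned
later. -/
lemma gapLarge_lower_tail {n k : ℕ} (hk : 1 ≤ k) {y θ : ℝ} (hy : 0 ≤ y) (hθ : 0 ≤ θ) :
    (unifSample (n + 1)).real (gapLarge (n + 1) k y) ≤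
      (n + 2) * Real.exp (θ * k - n * y * (1 - Real.exp (-θ))) := by
  have hk1 : ((k - 1 : ℕ) : ℝ) ≤ k := by exact_mod_cast Nat.sub_le k 1
  have he : 0 ≤ 1 - Real.exp (-θ) := by
    have := Real.exp_le_one_iff.2 (neg_nonpos.2 hθ)
    linarith
  have h1 : θ * ((k - 1 : ℕ) : ℝ) ≤ θ * k := by gcongr
  refine measureReal_gapLarge_le hk hy (Real.exp_pos _).le ?_ ?_ <;> intro I hI hp
  · refine (countIn_le_tail hI (k - 1) hθ hp.ge).trans (Real.exp_le_exp.2 ?_)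
    have : (n : ℝ) * y * (1 - Real.exp (-θ)) ≤ ((n + 1 : ℕ) : ℝ) * y * (1 - Real.exp (-θ)) := by
      gcongr; omega
    linarith
  · refine (countIn_le_tail hI (k - 1) hθ hp.ge).trans (Real.exp_le_exp.2 ?_)
    linarith

lemma gapLarge_upper_tail {n k m : ℕ} (hk : 1 ≤ k) (hkm : k + m = n + 1) {y θ : ℝ} (hy : 0 ≤ y)
    (hy1 : y ≤ 1) (hθ : 0 ≤ θ) :
    (unifSample (n + 1)).real (gapLarge (n + 1) k y) ≤
      (n + 2) * Real.exp (-(θ * m) + (n + 1) * (1 - y) * (Real.exp θ - 1)) := by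
  have he : 0 ≤ Real.exp θ - 1 := by
    have := Real.one_le_exp hθ
    linarith
  have hy2 : 0 ≤ 1 - y := by linarith
  refine measureReal_gapLarge_le hk hy (Real.exp_pos _).le ?_ ?_ <;> intro I hI hp
  · refine (countIn_le_tail_compl hI (k - 1) m hθ hp.ge (by omega)).trans (Real.exp_le_exp.2 ?_)
    push_cast
    exact le_rfl
  · refine (countIn_le_tail_compl hI (k - 1) m hθ hp.ge (by omega)).trans (Real.exp_le_exp.2 ?_)
    gcongr
    linarith

lemma gapSmall_upper_tail {n k : ℕ} (hk : 1 ≤ k) {y θ : ℝ} (hy : 0 ≤ y) (hθ : 0 ≤ θ) :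
    (unifSample (n + 1)).real (gapSmall (n + 1) k y) ≤
      (n + 2) * Real.exp (-(θ * k) + (n + 1) * y * (Real.exp θ - 1)) := by
  have he : 0 ≤ Real.exp θ - 1 := by
    have := Real.one_le_exp hθ
    linarith
  refine measureReal_gapSmall_le hk (Real.exp_pos _).le ?_ ?_ <;> intro I hI hp
  · refine (le_countIn_tail hI k hθ hp).trans (Real.exp_le_exp.2 ?_)
    push_cast
    exact le_rfl
  · refine (le_countIn_tail hI k hθ hp).trans (Real.exp_le_exp.2 ?_)
    gcongr
    linarith

lemma gapSmall_lower_tail {n k m : ℕ} (hk : 1 ≤ k) (hkm : k + m = n + 1) {y θ : ℝ} (hy1 : y ≤ 1)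
    (hθ : 0 ≤ θ) :
    (unifSample (n + 1)).real (gapSmall (n + 1) k y) ≤
      (n + 2) * Real.exp (θ * m - n * (1 - y) * (1 - Real.exp (-θ))) := by
  have he : 0 ≤ 1 - Real.exp (-θ) := by
    have := Real.exp_le_one_iff.2 (neg_nonpos.2 hθ)
    linarith
  have hy2 : 0 ≤ 1 - y := by linarith
  refine measureReal_gapSmall_le hk (Real.exp_pos _).le ?_ ?_ <;> intro I hI hp
  · refine (le_countIn_tail_compl hI k m hθ hp (by omega)).trans (Real.exp_le_exp.2 ?_)
    gcongr
    omega
  · exact le_countIn_tail_compl hI k m hθ hp (by omega)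

/-- When all but `m` of the points lie between two order statistics at distance less than `1 - z`,
one of the two end intervals of length `z / 2` holds at most `m` points. -/
lemma gapSmall_ends {n k m : ℕ} (hk : 1 ≤ k) (hkm : k + m = n) {z θ : ℝ} (hz : 0 ≤ z)
    (hz1 : z ≤ 1) (hθ : 0 ≤ θ) :
    (unifSample n).real (gapSmall n k (1 - z)) ≤
      2 * Real.exp (θ * m - n * (z / 2) * (1 - Real.exp (-θ))) := by
  have hsub : gapSmall n k (1 - z) ⊆
      {x | countIn (Set.Ioc 0 (0 + z / 2)) x ≤ m} ∪
      {x | countIn (Set.Ioc (1 - z / 2) (1 - z / 2 + z / 2)) x ≤ m} := by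
    rintro x ⟨hx, i, hik, hgap⟩
    -- Neither alternative leads to an event that depends on `i`, so no union over starting points
    -- is needed and the factor is 2 instead of order `n`.
    rcases lt_or_ge (z / 2) (orderStat x i) with hi | hi
    · left
      have hi0 : 1 ≤ i := by
        rcases Nat.eq_zero_or_pos i with rfl | h
        · rw [orderStat_zero] at hi
          linarith
        · exact h
      have := mt (orderStat_le_iff x hi0 (by omega) (z / 2)).2 (not_le.2 hi)
      simp only [Set.mem_ofPred_eq]
      rw [countIn_eq_card]
      have hle : (Finset.univ.filter fun b => x b ∈ Set.Ioc 0 (0 + z / 2)).card ≤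
          (Finset.univ.filter fun b => x b ≤ z / 2).card := by
        refine Finset.card_le_card fun b => ?_
        simp only [Finset.mem_filter, Finset.mem_univ, true_and, Set.mem_Ioc, zero_add]
        exact fun h => h.2
      omega
    · right
      have hj : orderStat x (i + k) ≤ 1 - z / 2 := by linarith
      have := (orderStat_le_iff x (by omega) hik _).1 hj
      have hc := countIn_add_compl (Set.Iic (1 - z / 2)) x
      rw [countIn_eq_card (Set.Iic (1 - z / 2))] at hc
      simp only [Set.mem_Iic] at hc
      have hle : countIn (Set.Ioc (1 - z / 2) (1 - z / 2 + z / 2)) x ≤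
          countIn (Set.Iic (1 - z / 2))ᶜ x := by
        classical
        rw [countIn_eq_card, countIn_eq_card]
        refine Finset.card_le_card fun b => ?_
        simp only [Finset.mem_filter, Finset.mem_univ, true_and, Set.mem_Ioc, Set.mem_compl_iff,
          Set.mem_Iic, not_le]
        exact fun h => h.1
      simp only [Set.mem_ofPred_eq]
      omega
  have h1 := countIn_le_tail (n := n) (I := Set.Ioc 0 (0 + z / 2)) measurableSet_Ioc m hθ
    (unif_real_Ioc le_rfl (by linarith) (by linarith)).ge
  have h2 := countIn_le_tail (n := n) (I := Set.Ioc (1 - z / 2) (1 - z / 2 + z / 2))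
    measurableSet_Ioc m hθ (unif_real_Ioc (by linarith) (by linarith) (by linarith)).ge
  refine (measureReal_mono hsub).trans ((measureReal_union_le _ _).trans ?_)
  linarith

/-! ### The normalization and the choice of the Chernoff parameter -/

/-- The denominator of `M_{i,j}` for `j - i = k`. -/
noncomputable def scale (n k : ℕ) : ℝ := Real.sqrt ((k : ℝ) * (1 - (k : ℝ) / n))

lemma scale_nonneg (n k : ℕ) : 0 ≤ scale n k := Real.sqrt_nonneg _

lemma scale_symm {n k m : ℕ} (h : k + m = n) (hn : 0 < n) : scale n k = scale n m := by
  have hn' : (n : ℝ) ≠ 0 := by positivity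
  have hk : (k : ℝ) = n - m := by rw [← h]; push_cast; ring
  rw [scale, scale, hk]
  congr 1
  field_simp
  ring

lemma scale_ge {n k : ℕ} (hk : 2 * k ≤ n) (hk1 : 1 ≤ k) : 7 / 10 * √(k : ℝ) ≤ scale n k := by
  refine Real.le_sqrt_of_sq_le ?_
  have hn : (0 : ℝ) < n := by exact_mod_cast (by omega : 0 < n)
  have h2 : (k : ℝ) / n ≤ 1 / 2 := by
    rw [div_le_iff₀ hn]
    have : (2 : ℝ) * k ≤ n := by exact_mod_cast hk
    linarith
  rw [mul_pow, Real.sq_sqrt (Nat.cast_nonneg k)]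
  nlinarith [(Nat.cast_nonneg k : (0 : ℝ) ≤ k)]

/-- Here `1 - k / n ≥ 0.936`. The value `27 / 20` for `k ≥ 2` is large enough that its product with
`4 / 5 ≤ 1 - e^{-2}` is `27 / 25 > 1`, which beats a factor `n`. -/
lemma scale_ge_of_small {n k : ℕ} (hn : 4000 ≤ n) (hk : k < 256) :
    9 / 10 * √(k : ℝ) ≤ scale n k ∧ (2 ≤ k → 27 / 20 ≤ scale n k) := by
  have hn0 : (0 : ℝ) < n := by exact_mod_cast (by omega : 0 < n)
  have hn1 : (4000 : ℝ) ≤ n := by exact_mod_cast hn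
  have hk' : (k : ℝ) ≤ 255 := by exact_mod_cast (by omega : k ≤ 255)
  have h2 : (k : ℝ) / n ≤ 64 / 1000 := by
    rw [div_le_iff₀ hn0]
    linarith
  have hk0 : (0 : ℝ) ≤ k := Nat.cast_nonneg k
  constructor
  · refine Real.le_sqrt_of_sq_le ?_
    rw [mul_pow, Real.sq_sqrt hk0]
    nlinarith
  · intro h
    have : (2 : ℝ) ≤ k := by exact_mod_cast h
    refine Real.le_sqrt_of_sq_le ?_
    nlinarith

lemma sub_sq_div_two_le_one_sub_exp_neg {θ : ℝ} (hθ : 0 ≤ θ) :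
    θ - θ ^ 2 / 2 ≤ 1 - Real.exp (-θ) := by
  have h := Real.quadratic_le_exp_of_nonneg hθ
  have hpos : 0 < 1 + θ + θ ^ 2 / 2 := by positivity
  have : Real.exp (-θ) ≤ (1 + θ + θ ^ 2 / 2)⁻¹ := by
    rw [Real.exp_neg]
    exact inv_anti₀ hpos h
  -- The product `(1 + θ + θ²/2) (1 - θ + θ²/2)` equals `1 + θ⁴/4`.
  have h2 : (1 + θ + θ ^ 2 / 2)⁻¹ ≤ 1 - θ + θ ^ 2 / 2 := by
    rw [inv_le_iff_one_le_mul₀ hpos]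
    nlinarith [pow_nonneg hθ 4]
  linarith

/-- The exponent in the lower tail bound for a moderately deviating window count. -/
lemma lower_exponent_le {n k : ℕ} (hk : 256 ≤ k) (hkn : 2 * k ≤ n + 1) {L y : ℝ} (hL : 0 ≤ L)
    (hy : y = (k + L * scale (n + 1) k) / (n + 1)) (hy1 : y ≤ 1) :
    8 / √(k : ℝ) * k - n * y * (1 - Real.exp (-(8 / √(k : ℝ)))) ≤ 36 - 3 * L := by
  set s := √(k : ℝ) with hs
  have hss : s * s = k := Real.mul_self_sqrt (Nat.cast_nonneg k)
  have hs16 : 16 ≤ s := by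
    refine Real.le_sqrt_of_sq_le ?_
    have : (256 : ℝ) ≤ k := by exact_mod_cast hk
    linarith
  have hs0 : 0 < s := by linarith
  -- With `θ` of order `1 / √k` a deviation `L √k` gains a multiple of `L`. As `s ≥ 16` gives `θ ≤
  -- 1/2`, the gain is at least `0.7 · 6 L ≥ 3 L`; the loss is `8² / 2 = 32`, plus at most 1 for `n`
  -- in place of `n + 1`.
  set θ := 8 / s with hθ
  have hθs : θ * s = 8 := div_mul_cancel₀ 8 hs0.ne'
  have hθ0 : 0 ≤ θ := by positivity
  have hθ1 : θ ≤ 1 / 2 := by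
    rw [hθ, div_le_iff₀ hs0]; linarith
  have hsc := scale_ge hkn (by omega)
  have hexp := sub_sq_div_two_le_one_sub_exp_neg hθ0
  have hexp1 : 1 - Real.exp (-θ) ≤ 1 := by linarith [Real.exp_pos (-θ)]
  have hn0 : (0 : ℝ) < (n : ℝ) + 1 := by positivity
  have hny : ((n : ℝ) + 1) * y = k + L * scale (n + 1) k := by
    rw [hy]; field_simp
  have hq : 0 ≤ θ - θ ^ 2 / 2 := by nlinarith
  have hE0 : 0 ≤ 1 - Real.exp (-θ) := hq.trans hexp
  have hLs : L * (7 / 10 * s) ≤ L * scale (n + 1) k := mul_le_mul_of_nonneg_left hsc hL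
  have hA : 0 ≤ s * s + L * (7 / 10 * s) := by positivity
  have h1 : (s * s + L * (7 / 10 * s)) * (θ - θ ^ 2 / 2) ≤
      (k + L * scale (n + 1) k) * (1 - Real.exp (-θ)) := by
    apply mul_le_mul _ hexp hq
    · rw [← hny]
      have := hny
      nlinarith
    · rw [hss]; linarith
  have h2 : (n : ℝ) * y * (1 - Real.exp (-θ)) =
      (k + L * scale (n + 1) k) * (1 - Real.exp (-θ)) - y * (1 - Real.exp (-θ)) := by
    rw [← hny]; ring
  have h3 : y * (1 - Real.exp (-θ)) ≤ 1 := by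
    nlinarith
  have h4 : (s * s + L * (7 / 10 * s)) * (θ - θ ^ 2 / 2) =
      8 * s - 32 + L * (7 / 10) * (8 - 4 * θ) := by
    have e1 : s * s * (θ - θ ^ 2 / 2) = (θ * s) * s - (θ * s) ^ 2 / 2 := by ring
    have e2 : L * (7 / 10 * s) * (θ - θ ^ 2 / 2) =
      L * (7 / 10) * (θ * s - (θ * s) * θ / 2) := by ring
    rw [add_mul, e1, e2, hθs]; ring
  have h5 : θ * k = 8 * s := by rw [← hss, ← mul_assoc, hθs]
  have h6 : L * (7 / 10) * 6 ≤ L * (7 / 10) * (8 - 4 * θ) := by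
    apply mul_le_mul_of_nonneg_left _ (by positivity)
    linarith
  rw [h5, h2]
  linarith

/-- The exponent in the upper tail bound for a moderately deviating window count. -/
lemma upper_exponent_le {n k : ℕ} (hk : 1 ≤ k) (hkn : 2 * k ≤ n + 1) {L y : ℝ} (hL : 9 ≤ L)
    (hy : y = (k - L * scale (n + 1) k) / (n + 1)) (hy0 : 0 ≤ y) :
    -(6 / √(k : ℝ) * k) + (n + 1) * y * (Real.exp (6 / √(k : ℝ)) - 1) ≤ 36 - 3 * L := by
  set s := √(k : ℝ) with hs
  have hss : s * s = k := Real.mul_self_sqrt (Nat.cast_nonneg k)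
  have hs0 : 0 < s := Real.sqrt_pos.2 (by exact_mod_cast hk)
  have hn0 : (0 : ℝ) < (n : ℝ) + 1 := by positivity
  have hny : ((n : ℝ) + 1) * y = k - L * scale (n + 1) k := by
    rw [hy]; field_simp
  have hsc := scale_ge hkn hk
  have hLs : L * (7 / 10 * s) ≤ L * scale (n + 1) k :=
    mul_le_mul_of_nonneg_left hsc (by linarith)
  have hny0 : 0 ≤ ((n : ℝ) + 1) * y := by positivity
  -- No lower bound on `k` is assumed: `0 ≤ y` forces `0.7 L √k ≤ k`, and `L ≥ 9` then gives `√k ≥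
  -- 6`, so that `θ = 6 / √k ≤ 1`.
  have hs6 : 6 ≤ s := by
    have : L * (7 / 10) * s ≤ s * s := by
      rw [hss]; linarith
    have := le_of_mul_le_mul_right this hs0
    linarith
  set θ := 6 / s with hθ
  have hθs : θ * s = 6 := div_mul_cancel₀ 6 hs0.ne'
  have hθ0 : 0 ≤ θ := by positivity
  have hθ1 : θ ≤ 1 := by
    rw [hθ, div_le_iff₀ hs0]; linarith
  have hexp : Real.exp θ - 1 ≤ θ + θ ^ 2 := by
    have := (abs_le.1 (Real.abs_exp_sub_one_sub_id_le (x := θ) (by rwa [abs_of_nonneg hθ0]))).2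
    linarith
  have h1 : ((n : ℝ) + 1) * y * (Real.exp θ - 1) ≤ (s * s - L * (7 / 10 * s)) * (θ + θ ^ 2) := by
    refine (mul_le_mul_of_nonneg_left hexp hny0).trans ?_
    apply mul_le_mul_of_nonneg_right _ (by positivity)
    rw [hny, hss]; linarith
  have h2 : (s * s - L * (7 / 10 * s)) * (θ + θ ^ 2) =
      6 * s + 36 - L * (7 / 10) * (6 + 6 * θ) := by
    have : (s * s - L * (7 / 10 * s)) * (θ + θ ^ 2) =
      (θ * s) * s + (θ * s) ^ 2 - L * (7 / 10) * (θ * s + (θ * s) * θ) := by ring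
    rw [this, hθs]; ring
  have h5 : θ * k = 6 * s := by rw [← hss, ← mul_assoc, hθs]
  have h6 : L * (7 / 10) * 6 ≤ L * (7 / 10) * (6 + 6 * θ) := by
    apply mul_le_mul_of_nonneg_left _ (by linarith)
    linarith
  rw [h5]
  linarith

lemma one_sub_exp_neg_two_ge : 4 / 5 ≤ 1 - Real.exp (-2) := by
  have h := Real.quadratic_le_exp_of_nonneg (x := 2) (by norm_num)
  have : Real.exp (-2) ≤ (5 : ℝ)⁻¹ := by
    rw [Real.exp_neg]
    exact inv_anti₀ (by norm_num) (by linarith)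
  linarith

/-- A long gap with `2 k > n + 1` leaves too little room for the remaining points. By the symmetry
of `scale` this is an upper deviation of the outside count on the same scale. The rate `3 L` is
chosen to absorb `n` starts and `n` lengths. -/
lemma gapLarge_le {n k : ℕ} (hk : 256 ≤ k) (hkn : k < n + 1) {L : ℝ} (hL : 9 ≤ L) :
    (unifSample (n + 1)).real
      (gapLarge (n + 1) k ((k + L * scale (n + 1) k) / (n + 1))) ≤
      (n + 2) * Real.exp (36 - 3 * L) := by
  have hsc := scale_nonneg (n + 1) k
  set y : ℝ := (k + L * scale (n + 1) k) / (n + 1) with hy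
  have hy0 : 0 ≤ y := by positivity
  rcases le_or_gt 1 y with hy1 | hy1
  · rw [gapLarge_eq_empty hy1, measureReal_empty]
    positivity
  rcases le_or_gt (2 * k) (n + 1) with h | h
  · refine (gapLarge_lower_tail (by omega) hy0 (θ := 8 / √(k : ℝ)) (by positivity)).trans ?_
    refine mul_le_mul_of_nonneg_left (Real.exp_le_exp.2 ?_) (by positivity)
    exact lower_exponent_le hk h (by linarith) hy hy1.le
  · obtain ⟨m, hm⟩ := Nat.exists_eq_add_of_lt hkn
    have hkm : k + (m + 1) = n + 1 := by omega
    have hz : 1 - y = (((m + 1 : ℕ) : ℝ) - L * scale (n + 1) (m + 1)) / (n + 1) := by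
      have : (n : ℝ) + 1 = k + ((m + 1 : ℕ) : ℝ) := by exact_mod_cast hkm.symm
      rw [hy, scale_symm hkm (by omega), eq_div_iff (by positivity), sub_mul, div_mul_cancel₀ _
        (by positivity), this]
      ring
    refine (gapLarge_upper_tail (by omega) hkm hy0 hy1.le
      (θ := 6 / √((m + 1 : ℕ) : ℝ)) (by positivity)).trans ?_
    refine mul_le_mul_of_nonneg_left (Real.exp_le_exp.2 ?_) (by positivity)
    exact upper_exponent_le (by omega) (by omega) hL hz (by linarith)

/-- For bounded `k` the fixed value `θ = 2` suffices: `2 k ≤ 512`, and the passage from `n + 1` to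
`n` costs at most 1. The rate `27 / 25` only has to absorb the starting points. -/
lemma gapLarge_le_of_small {n k : ℕ} (hn : 4000 ≤ n + 1) (hk2 : 2 ≤ k) (hk : k < 256) {L : ℝ}
    (hL : 0 ≤ L) :
    (unifSample (n + 1)).real
      (gapLarge (n + 1) k ((k + L * scale (n + 1) k) / (n + 1))) ≤
      (n + 2) * Real.exp (513 - 27 / 25 * L) := by
  have hsc := (scale_ge_of_small hn hk).2 hk2
  set y : ℝ := (k + L * scale (n + 1) k) / (n + 1) with hy
  have hy0 : 0 ≤ y := by positivity
  rcases le_or_gt 1 y with hy1 | hy1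
  · rw [gapLarge_eq_empty hy1, measureReal_empty]
    positivity
  refine (gapLarge_lower_tail (by omega) hy0 (θ := 2) (by norm_num)).trans ?_
  refine mul_le_mul_of_nonneg_left (Real.exp_le_exp.2 ?_) (by positivity)
  have hny : ((n : ℝ) + 1) * y = k + L * scale (n + 1) k := by
    rw [hy]; field_simp
  have hk' : (k : ℝ) ≤ 256 := by exact_mod_cast hk.le
  have hk0 : (0 : ℝ) ≤ k := Nat.cast_nonneg k
  have h1 : L * (27 / 20) * (4 / 5) ≤ ((n : ℝ) + 1) * y * (1 - Real.exp (-2)) := by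
    refine mul_le_mul ?_ one_sub_exp_neg_two_ge (by norm_num) (by positivity)
    rw [hny]
    have := mul_le_mul_of_nonneg_left hsc hL
    linarith
  have hE := one_sub_exp_neg_two_ge
  have hE1 := Real.exp_pos (-2)
  generalize Real.exp (-2) = e at hE hE1 h1 ⊢
  have h3 : y * (1 - e) ≤ 1 := mul_le_one₀ hy1.le (by linarith) (by linarith)
  have h4 : (n : ℝ) * y * (1 - e) = ((n : ℝ) + 1) * y * (1 - e) - y * (1 - e) := by ring
  linarith

/-- The condition `256 ≤ m` serves the case `2 k > n + 1`, where the outside count has a lower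
deviation. -/
lemma gapSmall_le {n k m : ℕ} (hk : 1 ≤ k) (hkm : k + m = n + 1) (hm : 256 ≤ m) {L : ℝ}
    (hL : 9 ≤ L) :
    (unifSample (n + 1)).real
      (gapSmall (n + 1) k ((k - L * scale (n + 1) k) / (n + 1))) ≤
      (n + 2) * Real.exp (36 - 3 * L) := by
  have hsc := scale_nonneg (n + 1) k
  set y : ℝ := (k - L * scale (n + 1) k) / (n + 1) with hy
  rcases le_or_gt y 0 with hy0 | hy0
  · rw [gapSmall_eq_empty hy0, measureReal_empty]
    positivity
  rcases le_or_gt (2 * k) (n + 1) with h | h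
  · refine (gapSmall_upper_tail hk hy0.le (θ := 6 / √(k : ℝ)) (by positivity)).trans ?_
    refine mul_le_mul_of_nonneg_left (Real.exp_le_exp.2 ?_) (by positivity)
    exact upper_exponent_le hk h hL hy hy0.le
  · have hz : 1 - y = ((m : ℝ) + L * scale (n + 1) m) / (n + 1) := by
      have : (n : ℝ) + 1 = k + m := by exact_mod_cast hkm.symm
      rw [hy, scale_symm hkm (by omega), eq_div_iff (by positivity), sub_mul, div_mul_cancel₀ _
        (by positivity), this]
      ring
    have hz0 : 0 ≤ 1 - y := by
      rw [hz]
      have := scale_nonneg (n + 1) m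
      positivity
    refine (gapSmall_lower_tail hk hkm (by linarith) (θ := 8 / √(m : ℝ)) (by positivity)).trans ?_
    refine mul_le_mul_of_nonneg_left (Real.exp_le_exp.2 ?_) (by positivity)
    exact lower_exponent_le hm (by omega) (by linarith) hz (by linarith)

/-- For `m = 1` the scale is below 1, so a factor `n + 2` for the starts would not be absorbed. The
end windows avoid it; halving `z` leaves the rate `(9 / 10) (4 / 5) / 2 ≥ 3 / 10`. -/
lemma gapSmall_le_of_small {n k m : ℕ} (hn : 4000 ≤ n + 1) (hk : 1 ≤ k) (hkm : k + m = n + 1)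
    (hm1 : 1 ≤ m) (hm : m < 256) {L : ℝ} (hL : 0 ≤ L) :
    (unifSample (n + 1)).real
      (gapSmall (n + 1) k ((k - L * scale (n + 1) k) / (n + 1))) ≤
      2 * Real.exp (513 - 3 / 10 * L) := by
  set z : ℝ := (m + L * scale (n + 1) m) / (n + 1) with hz
  have hsc0 := scale_nonneg (n + 1) m
  have hy : ((k : ℝ) - L * scale (n + 1) k) / (n + 1) = 1 - z := by
    have : (n : ℝ) + 1 = k + m := by exact_mod_cast hkm.symm
    rw [hz, scale_symm hkm (by omega), div_eq_iff (by positivity), sub_mul, div_mul_cancel₀ _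
        (by positivity), this]
    ring
  have hz0 : 0 ≤ z := by positivity
  rw [hy]
  rcases le_or_gt 1 z with hz1 | hz1
  · rw [gapSmall_eq_empty (by linarith), measureReal_empty]
    positivity
  refine (gapSmall_ends hk hkm hz0 hz1.le (θ := 2) (by norm_num)).trans ?_
  refine mul_le_mul_of_nonneg_left (Real.exp_le_exp.2 ?_) (by positivity)
  have hsc : 9 / 10 ≤ scale (n + 1) m := by
    refine le_trans ?_ (scale_ge_of_small hn hm).1
    have : 1 ≤ √(m : ℝ) := Real.one_le_sqrt.2 (by exact_mod_cast hm1)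
    linarith
  have hnz : ((n : ℝ) + 1) * z = m + L * scale (n + 1) m := by
    rw [hz]; field_simp
  have hm' : (m : ℝ) ≤ 256 := by exact_mod_cast hm.le
  have hm0 : (0 : ℝ) ≤ m := Nat.cast_nonneg m
  have h1 : L * (9 / 10) * (4 / 5) ≤ ((n : ℝ) + 1) * z * (1 - Real.exp (-2)) := by
    refine mul_le_mul ?_ one_sub_exp_neg_two_ge (by norm_num) (by positivity)
    rw [hnz]
    have := mul_le_mul_of_nonneg_left hsc hL
    linarith
  generalize Real.exp (-2) = e at h1 ⊢
  have h4 : ((n + 1 : ℕ) : ℝ) * (z / 2) * (1 - e) = ((n : ℝ) + 1) * z * (1 - e) / 2 := by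
    push_cast
    ring
  linarith

/-! ### Summation over all gap lengths -/

/-- Samples in the unit cube on which `-M_{i,j} > L` for some `j - i ≥ 2`. -/
def largeExcess (n : ℕ) (L : ℝ) : Set (Fin n → ℝ) :=
  ⋃ k ∈ Finset.Ico 2 n, gapLarge n k ((k + L * scale n k) / n)

/-- Samples in the unit cube on which `M_{i,j} > L` for some `i < j`. -/
def smallExcess (n : ℕ) (L : ℝ) : Set (Fin n → ℝ) :=
  ⋃ k ∈ Finset.Ico 1 n, gapSmall n k ((k - L * scale n k) / n)

/-- At most 256 exceptional lengths carry the weaker bound `B`, which therefore need not absorb a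
factor `n` for the lengths. -/
lemma sum_le_of_two_ranges {n : ℕ} {s : Finset ℕ} (hs : s ⊆ Finset.range (n + 1))
    {f : ℕ → ℝ} {p : ℕ → Prop} [DecidablePred p] (hp : (s.filter p).card ≤ 256)
    {A B : ℝ} (hA0 : 0 ≤ A) (hB0 : 0 ≤ B)
    (hA : ∀ k ∈ s, ¬ p k → f k ≤ A) (hB : ∀ k ∈ s, p k → f k ≤ B) :
    ∑ k ∈ s, f k ≤ (n + 1) * A + 256 * B := by
  rw [← Finset.sum_filter_not_add_sum_filter s p]
  refine add_le_add ?_ ?_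
  · refine (Finset.sum_le_card_nsmul _ _ A fun k hk => ?_).trans ?_
    · exact hA k (Finset.mem_filter.1 hk).1 (Finset.mem_filter.1 hk).2
    · rw [nsmul_eq_mul]
      gcongr
      have := Finset.card_le_card ((Finset.filter_subset (fun k => ¬ p k) s).trans hs)
      rw [Finset.card_range] at this
      exact_mod_cast this
  · refine (Finset.sum_le_card_nsmul _ _ B fun k hk => ?_).trans ?_
    · exact hB k (Finset.mem_filter.1 hk).1 (Finset.mem_filter.1 hk).2
    · rw [nsmul_eq_mul]
      gcongr
      exact_mod_cast hp

lemma measureReal_largeExcess_le {n : ℕ} (hn : 4000 ≤ n + 1) {L : ℝ} (hL : 9 ≤ L) :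
    (unifSample (n + 1)).real (largeExcess (n + 1) L) ≤
      (n + 1) * ((n + 2) * Real.exp (36 - 3 * L)) +
        256 * ((n + 2) * Real.exp (513 - 27 / 25 * L)) := by
  refine (measureReal_biUnion_finset_le _ _).trans ?_
  refine sum_le_of_two_ranges (p := fun k => k < 256) ?_ ?_ (by positivity) (by positivity) ?_ ?_
  · intro k hk
    simp only [Finset.mem_Ico, Finset.mem_range] at hk ⊢
    omega
  · refine (Finset.card_le_card (t := Finset.range 256) ?_).trans (by simp)
    intro k hk
    simpa using (Finset.mem_filter.1 hk).2
  · intro k hk hk'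
    rw [Finset.mem_Ico] at hk
    push_cast
    exact gapLarge_le (by omega) hk.2 hL
  · intro k hk hk'
    rw [Finset.mem_Ico] at hk
    push_cast
    exact gapLarge_le_of_small hn hk.1 hk' (by linarith)

lemma measureReal_smallExcess_le {n : ℕ} (hn : 4000 ≤ n + 1) {L : ℝ} (hL : 9 ≤ L) :
    (unifSample (n + 1)).real (smallExcess (n + 1) L) ≤
      (n + 1) * ((n + 2) * Real.exp (36 - 3 * L)) +
        256 * (2 * Real.exp (513 - 3 / 10 * L)) := by
  refine (measureReal_biUnion_finset_le _ _).trans ?_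
  refine sum_le_of_two_ranges (p := fun k => n + 1 < k + 256) ?_ ?_ (by positivity)
    (by positivity) ?_ ?_
  · intro k hk
    simp only [Finset.mem_Ico, Finset.mem_range] at hk ⊢
    omega
  · refine (Finset.card_le_card (t := Finset.Ico (n + 1 - 255) (n + 1)) ?_).trans ?_
    · intro k hk
      simp only [Finset.mem_filter, Finset.mem_Ico] at hk ⊢
      omega
    · rw [Nat.card_Ico]
      omega
  · intro k hk hk'
    rw [Finset.mem_Ico] at hk
    push_cast
    exact gapSmall_le (m := n + 1 - k) hk.1 (by omega) (by omega) hL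
  · intro k hk hk'
    rw [Finset.mem_Ico] at hk
    push_cast
    exact gapSmall_le_of_small (m := n + 1 - k) hn hk.1 (by omega) (by omega) (by omega)
      (by linarith)

lemma tendsto_log_natCast : Tendsto (fun n : ℕ => Real.log n) atTop atTop :=
  Real.tendsto_log_atTop.comp tendsto_natCast_atTop_atTop

lemma tendsto_exp_sub_mul_log {a b : ℝ} (hb : 0 < b) :
    Tendsto (fun n : ℕ => Real.exp (a - b * Real.log n)) atTop (𝓝 0) := by
  refine Real.tendsto_exp_atBot.comp ?_
  exact tendsto_atBot_add_const_left _ a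
    (tendsto_neg_atTop_atBot.comp (tendsto_log_natCast.const_mul_atTop hb))

lemma tendsto_largeExcess (τ : ℝ) :
    Tendsto (fun n : ℕ => (unifSample n).real (largeExcess n (Real.log n + τ))) atTop (𝓝 0) := by
  -- At `L = log n + τ` the two terms are of orders `n² n⁻³` and `n · n^{-27/25}`.
  have hbound : Tendsto (fun n : ℕ => 2 * Real.exp ((36 - 3 * τ) - 1 * Real.log n) +
      512 * Real.exp ((513 - 27 / 25 * τ) - 2 / 25 * Real.log n)) atTop (𝓝 0) := by
    simpa using ((tendsto_exp_sub_mul_log one_pos).const_mul 2).add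
      ((tendsto_exp_sub_mul_log (by norm_num : (0 : ℝ) < 2 / 25)).const_mul 512)
  refine squeeze_zero' (Eventually.of_forall fun _ => measureReal_nonneg) ?_ hbound
  filter_upwards [eventually_ge_atTop 4000,
    (tendsto_atTop_add_const_right _ τ tendsto_log_natCast).eventually_ge_atTop 9] with n hn hL
  obtain ⟨N, rfl⟩ : ∃ N, n = N + 1 := ⟨n - 1, by omega⟩
  refine (measureReal_largeExcess_le hn hL).trans ?_
  have hpos : (0 : ℝ) < ((N + 1 : ℕ) : ℝ) := by positivity
  set l := Real.log ((N + 1 : ℕ) : ℝ) with hl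
  have hexp : Real.exp l = (N : ℝ) + 1 := by rw [hl, Real.exp_log hpos]; push_cast; ring
  have h2 : (N : ℝ) + 2 ≤ 2 * Real.exp l := by rw [hexp]; linarith [(Nat.cast_nonneg N : (0:ℝ) ≤ N)]
  refine add_le_add ?_ ?_
  · calc ((N : ℝ) + 1) * ((N + 2) * Real.exp (36 - 3 * (l + τ)))
        ≤ Real.exp l * (2 * Real.exp l * Real.exp (36 - 3 * (l + τ))) := by rw [hexp] at *; gcongr
      _ = 2 * (Real.exp l * (Real.exp l * Real.exp (36 - 3 * (l + τ)))) := by ring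
      _ = 2 * Real.exp ((36 - 3 * τ) - 1 * l) := by
        rw [← Real.exp_add, ← Real.exp_add]; ring_nf
  · calc (256 : ℝ) * ((N + 2) * Real.exp (513 - 27 / 25 * (l + τ)))
        ≤ 256 * (2 * Real.exp l * Real.exp (513 - 27 / 25 * (l + τ))) := by gcongr
      _ = 512 * (Real.exp l * Real.exp (513 - 27 / 25 * (l + τ))) := by ring
      _ = 512 * Real.exp ((513 - 27 / 25 * τ) - 2 / 25 * l) := by
        rw [← Real.exp_add]; ring_nf

lemma tendsto_smallExcess (τ : ℝ) :
    Tendsto (fun n : ℕ => (unifSample n).real (smallExcess n (Real.log n + τ))) atTop (𝓝 0) := by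
  -- The orders are now `n² n⁻³` and `n^{-3/10}`.
  have hbound : Tendsto (fun n : ℕ => 2 * Real.exp ((36 - 3 * τ) - 1 * Real.log n) +
      512 * Real.exp ((513 - 3 / 10 * τ) - 3 / 10 * Real.log n)) atTop (𝓝 0) := by
    simpa using ((tendsto_exp_sub_mul_log one_pos).const_mul 2).add
      ((tendsto_exp_sub_mul_log (by norm_num : (0 : ℝ) < 3 / 10)).const_mul 512)
  refine squeeze_zero' (Eventually.of_forall fun _ => measureReal_nonneg) ?_ hbound
  filter_upwards [eventually_ge_atTop 4000,
    (tendsto_atTop_add_const_right _ τ tendsto_log_natCast).eventually_ge_atTop 9] with n hn hL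
  obtain ⟨N, rfl⟩ : ∃ N, n = N + 1 := ⟨n - 1, by omega⟩
  refine (measureReal_smallExcess_le hn hL).trans ?_
  have hpos : (0 : ℝ) < ((N + 1 : ℕ) : ℝ) := by positivity
  set l := Real.log ((N + 1 : ℕ) : ℝ) with hl
  have hexp : Real.exp l = (N : ℝ) + 1 := by rw [hl, Real.exp_log hpos]; push_cast; ring
  have h2 : (N : ℝ) + 2 ≤ 2 * Real.exp l := by rw [hexp]; linarith [(Nat.cast_nonneg N : (0:ℝ) ≤ N)]
  refine add_le_add ?_ ?_
  · calc ((N : ℝ) + 1) * ((N + 2) * Real.exp (36 - 3 * (l + τ)))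
        ≤ Real.exp l * (2 * Real.exp l * Real.exp (36 - 3 * (l + τ))) := by rw [hexp] at *; gcongr
      _ = 2 * (Real.exp l * (Real.exp l * Real.exp (36 - 3 * (l + τ)))) := by ring
      _ = 2 * Real.exp ((36 - 3 * τ) - 1 * l) := by
        rw [← Real.exp_add, ← Real.exp_add]; ring_nf
  · rw [show (513 : ℝ) - 3 / 10 * (l + τ) = (513 - 3 / 10 * τ) - 3 / 10 * l by ring]
    linarith

/-! ### Volume of the cut cube -/

/-- The part of the cube `(0, y]ⁿ` on which the coordinates sum to at most `t`. -/
def cutCube (n : ℕ) (y t : ℝ) : Set (Fin n → ℝ) :=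
  {g | (∀ i, g i ∈ Set.Ioc 0 y) ∧ ∑ i, g i ≤ t}

lemma measurableSet_cutCube_prod (n : ℕ) (y t : ℝ) :
    MeasurableSet {q : ℝ × (Fin n → ℝ) | q.1 ∈ Set.Ioc 0 y ∧ q.2 ∈ cutCube n y (t - q.1)} := by
  have hsum : Measurable fun q : ℝ × (Fin n → ℝ) => ∑ i, q.2 i :=
    Finset.measurable_sum _ fun i _ => (measurable_pi_apply i).comp measurable_snd
  refine (measurable_fst measurableSet_Ioc).inter (MeasurableSet.inter ?_ ?_)
  · exact MeasurableSet.congr (MeasurableSet.iInter fun i =>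
      ((measurable_pi_apply i).comp measurable_snd) measurableSet_Ioc)
      (by ext; simp; rfl : (⋂ i, (fun q : ℝ × (Fin n → ℝ) => q.2 i) ⁻¹' Set.Ioc 0 y) = _)
  · exact measurableSet_le hsum (measurable_const.sub measurable_fst)

lemma volume_cutCube_lt_top (n : ℕ) (y t : ℝ) : volume (cutCube n y t) < ⊤ := by
  refine (measure_mono (t := Set.univ.pi fun _ => Set.Ioc 0 y) ?_).trans_lt ?_
  · exact fun g hg i _ => hg.1 i
  · rw [volume_pi_pi]
    exact ENNReal.prod_lt_top fun i _ => by simp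

lemma measureReal_cutCube_succ (n : ℕ) {y : ℝ} (hy : 0 ≤ y) (t : ℝ) :
    volume.real (cutCube (n + 1) y t) = ∫ s in (0 : ℝ)..y, volume.real (cutCube n y (t - s)) := by
  set S := {q : ℝ × (Fin n → ℝ) | q.1 ∈ Set.Ioc 0 y ∧ q.2 ∈ cutCube n y (t - q.1)} with hS
  have hSm : MeasurableSet S := measurableSet_cutCube_prod n y t
  have hmp := volume_preserving_piFinSuccAbove (fun _ : Fin (n + 1) => ℝ) 0
  have h1 : volume (cutCube (n + 1) y t) = volume S := by
    rw [← hmp.measure_preimage hSm.nullMeasurableSet]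
    congr 1
    ext g
    simp only [cutCube, Set.mem_ofPred_eq, hS, Set.mem_preimage, Fin.forall_fin_succ,
      Fin.sum_univ_succ, and_assoc, MeasurableEquiv.piFinSuccAbove_apply, Fin.insertNthEquiv,
      Equiv.coe_fn_symm_mk, Fin.removeNth, Fin.zero_succAbove, le_sub_iff_add_le']
  have hmeas : Measurable fun s => volume (Prod.mk s ⁻¹' S) := measurable_measure_prodMk_left hSm
  have hsec : ∀ s, volume (Prod.mk s ⁻¹' S) =
      (Set.Ioc 0 y).indicator (fun s => volume (cutCube n y (t - s))) s := by
    intro s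
    by_cases hs : s ∈ Set.Ioc 0 y
    · rw [Set.indicator_of_mem hs]
      congr 1
      ext g
      simp [hS, hs.1, hs.2]
    · rw [Set.indicator_of_notMem hs]
      convert measure_empty (μ := volume)
      ext g
      simp only [hS, Set.mem_preimage, Set.mem_ofPred_eq, Set.mem_empty_iff_false, iff_false]
      exact fun h => hs h.1
  rw [measureReal_def, h1, Measure.volume_eq_prod, Measure.prod_apply hSm,
    ← integral_toReal hmeas.aemeasurable]
  · simp_rw [hsec]
    rw [intervalIntegral.integral_of_le hy, ← integral_indicator measurableSet_Ioc]
    congr 1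
    ext s
    by_cases hs : s ∈ Set.Ioc 0 y <;> simp [hs, measureReal_def]
  · refine ae_of_all _ fun s => ?_
    rw [hsec]
    by_cases hs : s ∈ Set.Ioc 0 y
    · simp [hs, volume_cutCube_lt_top]
    · simp [hs]

lemma integral_posPart_pow {n : ℕ} (hn : 1 ≤ n) {y : ℝ} (hy : 0 ≤ y) (c : ℝ) :
    ∫ s in (0 : ℝ)..y, ((n : ℝ) + 1) * (max (c - s) 0) ^ n =
      (max c 0) ^ (n + 1) - (max (c - y) 0) ^ (n + 1) := by
  have hcont : Continuous fun s : ℝ => -(max (c - s) 0) ^ (n + 1) := by fun_prop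
  have hcont' : Continuous fun s : ℝ => ((n : ℝ) + 1) * (max (c - s) 0) ^ n := by fun_prop
  rw [integral_eq_of_hasDerivAt_off_countable_of_le (fun s : ℝ => -(max (c - s) 0) ^ (n + 1)) _ hy
    (Set.countable_singleton c) hcont.continuousOn ?_ (hcont'.intervalIntegrable _ _)]
  · simp only [sub_zero]; ring
  · rintro s ⟨-, hs⟩
    rcases lt_or_gt_of_ne (show s ≠ c from hs) with h | h
    · have h1 : HasDerivAt (fun s : ℝ => -(c - s) ^ (n + 1))
          (-(((n + 1 : ℕ) : ℝ) * (c - s) ^ n * (0 - 1))) s :=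
        (((hasDerivAt_const s c).sub (hasDerivAt_id s)).pow (n + 1)).neg
      have h2 : (fun s : ℝ => -(max (c - s) 0) ^ (n + 1)) =ᶠ[𝓝 s] fun s => -(c - s) ^ (n + 1) := by
        filter_upwards [eventually_lt_nhds h] with u hu
        rw [max_eq_left (by linarith)]
      refine (h1.congr_of_eventuallyEq h2).congr_deriv ?_
      rw [max_eq_left (by linarith)]
      push_cast
      ring
    · have h2 : (fun s : ℝ => -(max (c - s) 0) ^ (n + 1)) =ᶠ[𝓝 s] fun _ => 0 := by
        filter_upwards [eventually_gt_nhds h] with u hu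
        rw [max_eq_right (by linarith)]
        simp
      refine ((hasDerivAt_const s (0 : ℝ)).congr_of_eventuallyEq h2).congr_deriv ?_
      -- Here `1 ≤ n` is needed: for `n = 0` the integrand would be 1 beyond `c`.
      rw [max_eq_right (by linarith), zero_pow (by omega), mul_zero]

/-- Pascal's rule. Integrating over one more coordinate turns each power into a difference of
consecutive terms, and this identity reassembles the sum. -/
lemma sum_alternating_choose_sub (n : ℕ) (a : ℕ → ℝ) :
    ∑ k ∈ Finset.range (n + 1), (-1) ^ k * (n.choose k : ℝ) * (a k - a (k + 1)) =
      ∑ k ∈ Finset.range (n + 2), (-1) ^ k * ((n + 1).choose k : ℝ) * a k := by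
  have h1 : ∑ k ∈ Finset.range (n + 1), (-1) ^ k * (n.choose k : ℝ) * a k =
      ∑ k ∈ Finset.range (n + 1), (-1) ^ (k + 1) * (n.choose (k + 1) : ℝ) * a (k + 1) + a 0 := by
    have := Finset.sum_range_succ' (fun k => (-1) ^ k * (n.choose k : ℝ) * a k) (n + 1)
    rw [Finset.sum_range_succ] at this
    simpa using this
  rw [Finset.sum_range_succ' _ (n + 1)]
  simp only [mul_sub, Finset.sum_sub_distrib]
  rw [h1]
  simp only [Nat.choose_succ_succ, Nat.cast_add, mul_add, add_mul, Finset.sum_add_distrib, pow_succ,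
    mul_neg, neg_mul, mul_one, Finset.sum_neg_distrib]
  simp
  ring

/-- The volume of a cube of side `y` cut by a hyperplane orthogonal to its diagonal. -/
lemma measureReal_cutCube {n : ℕ} (hn : 1 ≤ n) {y : ℝ} (hy : 0 ≤ y) (t : ℝ) :
    (n.factorial : ℝ) * volume.real (cutCube n y t) =
      ∑ k ∈ Finset.range (n + 1), (-1) ^ k * (n.choose k : ℝ) * (max (t - k * y) 0) ^ n := by
  -- The induction starts at 1 because the formula fails for `n = 0` and `t < 0`, where `0 ^ 0 = 1`.
  induction n, hn using Nat.le_induction generalizing t with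
  | base =>
    have h0 : ∀ s : ℝ, volume.real (cutCube 0 y (t - s)) = (Set.Iic t).indicator (fun _ => 1) s := by
      intro s
      by_cases hs : s ≤ t
      · have : cutCube 0 y (t - s) = Set.univ := by ext; simp [cutCube, hs]
        simp [this, hs, measureReal_def, volume_pi]
      · have : cutCube 0 y (t - s) = ∅ := by ext; simpa [cutCube] using hs
        simp [this, hs]
    rw [measureReal_cutCube_succ 0 hy]
    simp_rw [h0]
    rw [intervalIntegral.integral_of_le hy, setIntegral_indicator measurableSet_Iic]
    have : Set.Ioc 0 y ∩ Set.Iic t = Set.Ioc 0 (min y t) := by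
      ext; simp
    rw [this]
    simp [Finset.sum_range_succ]
    rcases le_total y t with h | h <;> rcases le_total 0 t with h' | h' <;>
      simp [h, h', hy]
    linarith
  | succ n hn ih =>
    rw [measureReal_cutCube_succ n hy, ← sum_alternating_choose_sub, ← intervalIntegral.integral_const_mul]
    have hint : ∀ k : ℕ, IntervalIntegrable (fun s : ℝ => (-1) ^ k * (n.choose k : ℝ) *
        (((n : ℝ) + 1) * (max (t - k * y - s) 0) ^ n)) volume 0 y := fun k =>
      Continuous.intervalIntegrable (by fun_prop) _ _
    calc ∫ s in (0 : ℝ)..y, ((n + 1).factorial : ℝ) * volume.real (cutCube n y (t - s))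
        = ∫ s in (0 : ℝ)..y, ∑ k ∈ Finset.range (n + 1), (-1) ^ k * (n.choose k : ℝ) *
            (((n : ℝ) + 1) * (max (t - k * y - s) 0) ^ n) := by
          congr 1
          ext s
          rw [Nat.factorial_succ, Nat.cast_mul, mul_assoc, ih, Finset.mul_sum]
          refine Finset.sum_congr rfl fun k _ => ?_
          rw [sub_right_comm]
          push_cast
          ring
      _ = ∑ k ∈ Finset.range (n + 1), (-1) ^ k * (n.choose k : ℝ) *
            ((max (t - k * y) 0) ^ (n + 1) - (max (t - (k + 1 : ℕ) * y) 0) ^ (n + 1)) := by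
          rw [intervalIntegral.integral_finsetSum fun k _ => hint k]
          refine Finset.sum_congr rfl fun k _ => ?_
          rw [intervalIntegral.integral_const_mul, integral_posPart_pow hn hy]
          push_cast
          rw [add_mul, one_mul, sub_sub]

/-! ### Exact law of the largest spacing -/

/-- Samples whose gaps `x₍ᵢ₊₁₎ - x₍ᵢ₎`, `0 ≤ i < n`, are all at most `y`. -/
def gapsLe (n : ℕ) (y : ℝ) : Set (Fin n → ℝ) :=
  {x | ∀ i < n, orderStat x (i + 1) - orderStat x i ≤ y}

lemma measurableSet_gapsLe (n : ℕ) (y : ℝ) : MeasurableSet (gapsLe n y) := by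
  have : gapsLe n y = ⋂ i, ⋂ (_ : i < n),
      {x : Fin n → ℝ | orderStat x (i + 1) - orderStat x i ≤ y} := by
    ext; simp [gapsLe]
  rw [this]
  exact MeasurableSet.iInter fun i => MeasurableSet.iInter fun _ =>
    measurableSet_le ((measurable_orderStat _).sub (measurable_orderStat _)) measurable_const

lemma orderStat_comp_perm {n : ℕ} (x : Fin n → ℝ) (σ : Equiv.Perm (Fin n)) (k : ℕ) :
    orderStat (x ∘ σ) k = orderStat x k := by
  by_cases h : 1 ≤ k ∧ k ≤ n
  · rw [orderStat_of_mem _ h, orderStat_of_mem _ h]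
    exact congrFun (Tuple.comp_perm_comp_sort_eq_comp_sort (f := x) (σ := σ)) _
  · simp only [orderStat, dif_neg h]

lemma orderStat_of_monotone {n : ℕ} {x : Fin n → ℝ} (hx : Monotone x) {k : ℕ} (hk : k < n) :
    orderStat x (k + 1) = x ⟨k, hk⟩ := by
  rw [orderStat_of_mem x ⟨by omega, by omega⟩, Tuple.sort_eq_refl_iff_monotone.2 hx]
  rfl

/-- The sum of the first `k` coordinates. -/
noncomputable def partialSum {n : ℕ} (g : Fin n → ℝ) (k : ℕ) : ℝ :=
  ∑ j : Fin n, if (j : ℕ) < k then g j else 0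

lemma partialSum_zero {n : ℕ} (g : Fin n → ℝ) : partialSum g 0 = 0 := by
  simp [partialSum]

lemma partialSum_succ {n : ℕ} (g : Fin n → ℝ) {k : ℕ} (hk : k < n) :
    partialSum g (k + 1) = partialSum g k + g ⟨k, hk⟩ := by
  have : g ⟨k, hk⟩ = ∑ j : Fin n, if j = ⟨k, hk⟩ then g j else 0 := by simp
  rw [partialSum, partialSum, this, ← Finset.sum_add_distrib]
  refine Finset.sum_congr rfl fun j _ => ?_
  rcases lt_trichotomy (j : ℕ) k with h | h | h
  · simp [h, Nat.lt_succ_of_lt h, Fin.ext_iff, h.ne]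
  · simp [h, Fin.ext_iff]
  · simp [h.ne', Fin.ext_iff, h.not_gt, show ¬ (j : ℕ) < k + 1 by omega]

lemma partialSum_self {n : ℕ} (g : Fin n → ℝ) : partialSum g n = ∑ j, g j := by
  simp [partialSum]

lemma partialSum_strictMono {n : ℕ} {g : Fin n → ℝ} (hg : ∀ j, 0 < g j) {k l : ℕ} (hkl : k < l)
    (hl : l ≤ n) : partialSum g k < partialSum g l := by
  induction l, hkl using Nat.le_induction with
  | base => rw [partialSum_succ g hl]; linarith [hg ⟨k, hl⟩]
  | succ l _ ih =>
    rw [partialSum_succ g hl]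
    linarith [hg ⟨l, hl⟩, ih (by omega)]

/-- The matrix of the map that sends a vector to the vector of its partial sums. -/
def cumMatrix (n : ℕ) : Matrix (Fin n) (Fin n) ℝ :=
  Matrix.of fun i j => if j ≤ i then 1 else 0

lemma det_cumMatrix (n : ℕ) : (cumMatrix n).det = 1 := by
  rw [Matrix.det_of_isLowerTriangular]
  · simp [cumMatrix]
  · intro i j hij
    have : i < j := hij
    simp [cumMatrix, this]

lemma toLin'_cumMatrix {n : ℕ} (g : Fin n → ℝ) (i : Fin n) :
    Matrix.toLin' (cumMatrix n) g i = partialSum g (i + 1) := by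
  rw [Matrix.toLin'_apply, Matrix.mulVec, dotProduct, partialSum]
  refine Finset.sum_congr rfl fun j _ => ?_
  simp [cumMatrix]

lemma measurePreserving_cumMatrix (n : ℕ) :
    MeasurePreserving (Matrix.toLin' (cumMatrix n)) volume volume := by
  refine ⟨(LinearMap.continuous_of_finiteDimensional _).measurable, ?_⟩
  rw [Real.map_matrix_volume_pi_eq_smul_volume_pi (by rw [det_cumMatrix]; exact one_ne_zero),
    det_cumMatrix]
  simp

/-- Samples in `(0, 1]ⁿ` whose gaps are all at most `y`. -/
def gapsLeCube (n : ℕ) (y : ℝ) : Set (Fin n → ℝ) :=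
  {x | (∀ b, x b ∈ Set.Ioc (0 : ℝ) 1) ∧ x ∈ gapsLe n y}

lemma measurableSet_gapsLeCube (n : ℕ) (y : ℝ) : MeasurableSet (gapsLeCube n y) := by
  refine MeasurableSet.inter ?_ (measurableSet_gapsLe n y)
  exact MeasurableSet.congr (MeasurableSet.univ_pi fun _ : Fin n => measurableSet_Ioc)
    (by ext; simp; rfl : (Set.univ.pi fun _ : Fin n => Set.Ioc (0 : ℝ) 1) = _)

lemma measurableSet_strictMono_comp {n : ℕ} (σ : Equiv.Perm (Fin n)) :
    MeasurableSet {x : Fin n → ℝ | StrictMono (x ∘ σ)} := by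
  have : {x : Fin n → ℝ | StrictMono (x ∘ σ)} =
      ⋂ i, ⋂ j, ⋂ (_ : i < j), {x : Fin n → ℝ | x (σ i) < x (σ j)} := by
    ext; simp [StrictMono]
  rw [this]
  exact MeasurableSet.iInter fun i => MeasurableSet.iInter fun j => MeasurableSet.iInter fun _ =>
    measurableSet_lt (measurable_pi_apply _) (measurable_pi_apply _)

/-- The spacings are coordinates for increasing samples: their positivity is strict monotonicity
together with a positive first point, and their sum is the last point. The spacing after the last
point is not constrained by `y`, hence `≤ 1` for the sum. -/
lemma preimage_cumMatrix {n : ℕ} (y : ℝ) :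
    Matrix.toLin' (cumMatrix n) ⁻¹' (gapsLeCube n y ∩ {x | StrictMono x}) = cutCube n y 1 := by
  ext g
  set x := Matrix.toLin' (cumMatrix n) g with hx
  have hxi : ∀ i : Fin n, x i = partialSum g (i + 1) := toLin'_cumMatrix g
  have hO : Monotone x → ∀ k ≤ n, orderStat x k = partialSum g k := by
    intro hm k hk
    rcases Nat.eq_zero_or_pos k with rfl | h
    · rw [orderStat_zero, partialSum_zero]
    · obtain ⟨k, rfl⟩ : ∃ l, k = l + 1 := ⟨k - 1, by omega⟩
      rw [orderStat_of_monotone hm hk, hxi]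
  have hgap : Monotone x → ∀ i : Fin n, orderStat x (i + 1) - orderStat x i = g i := by
    intro hm i
    rw [hO hm _ i.2, hO hm _ i.2.le, partialSum_succ g i.2]
    simp
  rw [Set.mem_preimage, ← hx]
  constructor
  · rintro ⟨⟨hcube, hle⟩, hmono⟩
    have hmono : StrictMono x := hmono
    refine ⟨fun i => ⟨?_, ?_⟩, ?_⟩
    · obtain ⟨i, hi⟩ := i
      have := partialSum_succ g hi
      rcases Nat.eq_zero_or_pos i with rfl | h
      · have h0 := (hcube ⟨0, hi⟩).1
        rw [hxi] at h0
        rw [partialSum_zero] at this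
        simp only at h0
        linarith
      · have h0 := hmono (show (⟨i - 1, by omega⟩ : Fin n) < ⟨i, hi⟩ from Nat.sub_lt h one_pos)
        rw [hxi, hxi] at h0
        simp only [Nat.sub_add_cancel h] at h0
        linarith
    · rw [← hgap hmono.monotone i]
      exact hle i i.2
    · rw [← partialSum_self]
      rcases Nat.eq_zero_or_pos n with rfl | h
      · rw [partialSum_zero]; exact zero_le_one
      · have := (hcube ⟨n - 1, by omega⟩).2
        rw [hxi] at this
        simpa only [Nat.sub_add_cancel h] using this
  · rintro ⟨hg, hsum⟩
    have hpos : ∀ j, 0 < g j := fun j => (hg j).1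
    have hmono : StrictMono x := by
      intro i j hij
      rw [hxi, hxi]
      exact partialSum_strictMono hpos (Nat.succ_lt_succ hij) j.2
    refine ⟨⟨fun b => ⟨?_, ?_⟩, fun i hi => ?_⟩, hmono⟩
    · rw [hxi, ← partialSum_zero g]
      exact partialSum_strictMono hpos (Nat.succ_pos _) b.2
    · rw [hxi]
      refine le_trans ?_ hsum
      rw [← partialSum_self]
      rcases Nat.lt_or_ge (b + 1) n with h | h
      · exact (partialSum_strictMono hpos h le_rfl).le
      · rw [le_antisymm b.2 h]
    · rw [hgap hmono.monotone ⟨i, hi⟩]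
      exact (hg _).2

lemma volume_gapsLeCube_strictMono (n : ℕ) (y : ℝ) :
    volume (gapsLeCube n y ∩ {x | StrictMono x}) = volume (cutCube n y 1) := by
  rw [← preimage_cumMatrix]
  refine ((measurePreserving_cumMatrix n).measure_preimage ?_).symm
  exact ((measurableSet_gapsLeCube n y).inter
    (measurableSet_strictMono_comp (Equiv.refl _))).nullMeasurableSet

/-- The gaps depend on the sample only through its order statistics, so all orderings contribute
equally. -/
lemma volume_gapsLeCube_strictMono_comp {n : ℕ} (y : ℝ) (σ : Equiv.Perm (Fin n)) :
    volume (gapsLeCube n y ∩ {x | StrictMono (x ∘ σ)}) = volume (cutCube n y 1) := by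
  rw [← volume_gapsLeCube_strictMono]
  have hmp := volume_measurePreserving_piCongrLeft (fun _ : Fin n => ℝ) σ.symm
  have hap : ∀ x : Fin n → ℝ, MeasurableEquiv.piCongrLeft (fun _ : Fin n => ℝ) σ.symm x = x ∘ σ := by
    intro x
    ext i
    have := Equiv.piCongrLeft_apply_apply (fun _ : Fin n => ℝ) σ.symm x (σ i)
    rw [MeasurableEquiv.coe_piCongrLeft]
    simpa using this
  have hm : MeasurableSet (gapsLeCube n y ∩ {x | StrictMono x}) :=
    (measurableSet_gapsLeCube n y).inter (measurableSet_strictMono_comp (Equiv.refl _))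
  rw [← hmp.measure_preimage hm.nullMeasurableSet]
  congr 1
  ext x
  simp only [Set.mem_preimage, hap, Set.mem_inter_iff, gapsLeCube, gapsLe, Set.mem_ofPred_eq,
    orderStat_comp_perm, Function.comp_apply]
  refine and_congr_left fun _ => and_congr_left fun _ => ?_
  exact ⟨fun h b => h (σ b), fun h b => by simpa using h (σ.symm b)⟩

lemma volume_coord_eq {n : ℕ} {a b : Fin n} (hab : a ≠ b) :
    volume {x : Fin n → ℝ | x a = x b} = 0 := by
  have h := Measure.addHaar_submodule (volume : Measure (Fin n → ℝ))
    (LinearMap.ker (LinearMap.proj (R := ℝ) (φ := fun _ : Fin n => ℝ) a -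
      LinearMap.proj (R := ℝ) (φ := fun _ : Fin n => ℝ) b)) ?_
  · convert h using 2
    ext x
    simp [sub_eq_zero]
  · intro htop
    have : Pi.single a (1 : ℝ) ∈ (⊤ : Submodule ℝ (Fin n → ℝ)) := trivial
    rw [← htop, LinearMap.mem_ker] at this
    simp [hab] at this

lemma ae_injective (n : ℕ) : ∀ᵐ x : Fin n → ℝ, Function.Injective x := by
  have h : ∀ᵐ x : Fin n → ℝ, ∀ a b, a ≠ b → x a ≠ x b := by
    simp only [ae_all_iff]
    exact fun a b hab => measure_eq_zero_iff_ae_notMem.1 (volume_coord_eq hab)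
  filter_upwards [h] with x hx a b hab
  by_contra hne
  exact hx a b hne hab

lemma volume_coord_zero {n : ℕ} (a : Fin n) : volume {x : Fin n → ℝ | x a = 0} = 0 :=
  Measure.pi_hyperplane _ a 0

/-- Up to ties the cube splits into `n!` chambers, one for each ordering, of equal contribution;
this is the factorial in `measureReal_cutCube`. The sum is inclusion–exclusion over the spacings
exceeding `y`. -/
lemma measureReal_gapsLe {n : ℕ} (hn : 1 ≤ n) {y : ℝ} (hy : 0 ≤ y) :
    (unifSample n).real (gapsLe n y) =
      ∑ k ∈ Finset.range (n + 1), (-1) ^ k * (n.choose k : ℝ) * (max (1 - k * y) 0) ^ n := by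
  have h1 : unifSample n (gapsLe n y) = volume (gapsLeCube n y) := by
    have : unifSample n = volume.restrict (Set.univ.pi fun _ => Set.Icc (0 : ℝ) 1) :=
      (Measure.restrict_pi_pi (fun _ : Fin n => (volume : Measure ℝ)) _).symm
    rw [this, Measure.restrict_apply (measurableSet_gapsLe n y)]
    refine measure_congr ?_
    have h0 : ∀ᵐ x : Fin n → ℝ, ∀ a, x a ≠ 0 := by
      rw [ae_all_iff]
      exact fun a => measure_eq_zero_iff_ae_notMem.1 (volume_coord_zero a)
    filter_upwards [h0] with x hx
    refine propext ⟨fun h => ⟨fun b => ?_, h.1⟩, fun h => ⟨h.2, fun b _ => ?_⟩⟩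
    · have := h.2 b trivial
      exact ⟨lt_of_le_of_ne this.1 (hx b).symm, this.2⟩
    · exact ⟨(h.1 b).1.le, (h.1 b).2⟩
  have h2 : volume (gapsLeCube n y) =
      volume (⋃ σ : Equiv.Perm (Fin n), gapsLeCube n y ∩ {x | StrictMono (x ∘ σ)}) := by
    refine measure_congr ?_
    filter_upwards [ae_injective n] with x hx
    refine propext ⟨fun h => Set.mem_iUnion.2 ⟨Tuple.sort x, h, ?_⟩, fun h => ?_⟩
    · exact (Tuple.monotone_sort x).strictMono_of_injective
        (hx.comp (Tuple.sort x).injective)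
    · obtain ⟨σ, h, -⟩ := Set.mem_iUnion.1 h
      exact h
  have h3 : volume (⋃ σ : Equiv.Perm (Fin n), gapsLeCube n y ∩ {x | StrictMono (x ∘ σ)}) =
      n.factorial * volume (cutCube n y 1) := by
    rw [measure_iUnion]
    · simp only [volume_gapsLeCube_strictMono_comp]
      rw [tsum_fintype, Finset.sum_const, Finset.card_univ, Fintype.card_perm, Fintype.card_fin,
        nsmul_eq_mul]
    · intro σ τ hne
      refine Set.disjoint_left.2 fun x hσ hτ => hne ?_
      have hσ : StrictMono (x ∘ σ) := hσ.2
      have hτ : StrictMono (x ∘ τ) := hτ.2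
      have hinj : Function.Injective x := (σ.injective_comp x).1 hσ.injective
      ext i
      exact congrArg Fin.val (hinj (congrFun (Tuple.unique_monotone hσ.monotone hτ.monotone) i))
    · exact fun σ => (measurableSet_gapsLeCube n y).inter (measurableSet_strictMono_comp σ)
  rw [← measureReal_cutCube hn hy 1, measureReal_def, h1, h2, h3, ENNReal.toReal_mul,
    measureReal_def]
  simp

/-! ### Gumbel limit of the alternating sum -/

lemma tendsto_pow_log_div (p : ℕ) :
    Tendsto (fun n : ℕ => Real.log n ^ p / n) atTop (𝓝 0) := by
  simpa [Function.comp_def] using (Real.tendsto_pow_log_div_mul_add_atTop 1 0 p one_ne_zero).comp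
    tendsto_natCast_atTop_atTop

/-- If `n yₙ - log n → c`, then `n yₙ² → 0`. -/
lemma tendsto_mul_sq {y : ℕ → ℝ} {c : ℝ}
    (h : Tendsto (fun n : ℕ => n * y n - Real.log n) atTop (𝓝 c)) :
    Tendsto (fun n : ℕ => n * y n ^ 2) atTop (𝓝 0) := by
  have hinv : Tendsto (fun n : ℕ => ((n : ℝ))⁻¹) atTop (𝓝 0) :=
    tendsto_inv_atTop_zero.comp tendsto_natCast_atTop_atTop
  -- Expand `n y² = (log n + (n y - log n))² / n`.
  have h1 := ((tendsto_pow_log_div 2).add ((h.mul (tendsto_pow_log_div 1)).const_mul 2)).add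
    ((h.pow 2).mul hinv)
  simp only [mul_zero, add_zero] at h1
  refine h1.congr' ?_
  filter_upwards [eventually_gt_atTop 0] with n hn
  have : (n : ℝ) ≠ 0 := by positivity
  field_simp
  ring

lemma posPart_pow_le_exp (n : ℕ) (u : ℝ) : (max (1 - u) 0) ^ n ≤ Real.exp (-(n * u)) := by
  rw [← mul_neg, Real.exp_nat_mul]
  refine pow_le_pow_left₀ (le_max_right _ _) (max_le ?_ (Real.exp_pos _).le) n
  linarith [Real.add_one_le_exp (-u)]

/-- With `u = k yₙ`, the quantity lies between `(1 - u²)ⁿ ≥ 1 - n u²` and 1, and `n u² → 0`. -/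
lemma tendsto_posPart_pow_mul_exp {y : ℕ → ℝ} {c : ℝ}
    (h : Tendsto (fun n : ℕ => n * y n - Real.log n) atTop (𝓝 c)) (hy : ∀ᶠ n in atTop, 0 ≤ y n)
    (k : ℕ) :
    Tendsto (fun n : ℕ => (max (1 - k * y n) 0) ^ n * Real.exp (n * (k * y n))) atTop (𝓝 1) := by
  have hsq : Tendsto (fun n : ℕ => (k : ℝ) ^ 2 * (n * y n ^ 2)) atTop (𝓝 0) := by
    simpa using (tendsto_mul_sq h).const_mul ((k : ℝ) ^ 2)
  have hlow : Tendsto (fun n : ℕ => 1 - (k : ℝ) ^ 2 * (n * y n ^ 2)) atTop (𝓝 1) := by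
    simpa using hsq.const_sub 1
  refine tendsto_of_tendsto_of_tendsto_of_le_of_le' hlow tendsto_const_nhds ?_ ?_
  · filter_upwards [hy, hsq.eventually_le_const one_pos, eventually_ge_atTop 1] with n hn h1 hn1
    have hn1' : (1 : ℝ) ≤ n := by exact_mod_cast hn1
    have hky : 0 ≤ (k : ℝ) * y n := by positivity
    have hle : (k * y n) ^ 2 ≤ 1 := by
      have : (k * y n) ^ 2 * 1 ≤ (k * y n) ^ 2 * n := by gcongr
      linarith [show (k : ℝ) ^ 2 * (n * y n ^ 2) = (k * y n) ^ 2 * n by ring]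
    rw [Real.exp_nat_mul, ← mul_pow]
    have hbase : 1 + -(k * y n) ^ 2 ≤ max (1 - k * y n) 0 * Real.exp (k * y n) :=
      calc 1 + -(k * y n) ^ 2 = (1 - k * y n) * (1 + k * y n) := by ring
        _ ≤ max (1 - k * y n) 0 * (1 + k * y n) := by
          gcongr; exact le_max_left _ _
        _ ≤ max (1 - k * y n) 0 * Real.exp (k * y n) := by
          gcongr; linarith [Real.add_one_le_exp (k * y n)]
    calc 1 - (k : ℝ) ^ 2 * (n * y n ^ 2) = 1 + n * -(k * y n) ^ 2 := by ring
      _ ≤ (1 + -(k * y n) ^ 2) ^ n := one_add_mul_le_pow (by linarith) n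
      _ ≤ _ := pow_le_pow_left₀ (by linarith) hbase n
  · refine Eventually.of_forall fun n => ?_
    have := posPart_pow_le_exp n (k * y n)
    calc _ ≤ Real.exp (-(n * (k * y n))) * Real.exp (n * (k * y n)) := by gcongr
      _ = 1 := by rw [← Real.exp_add]; simp

lemma tendsto_choose_div_pow (k : ℕ) :
    Tendsto (fun n : ℕ => (n.choose k : ℝ) / n ^ k) atTop (𝓝 (1 / k.factorial)) := by
  have hne : ∀ᶠ n : ℕ in atTop, (n : ℝ) ^ k / k.factorial ≠ 0 := by
    filter_upwards [eventually_gt_atTop 0] with n hn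
    positivity
  have := ((Asymptotics.isEquivalent_iff_tendsto_one hne).1 (isEquivalent_choose k)).mul_const
    (1 / (k.factorial : ℝ))
  rw [one_mul] at this
  refine this.congr' ?_
  filter_upwards [eventually_gt_atTop 0] with n hn
  simp only [Pi.div_apply]
  field_simp

/-- The distribution function of the largest spacing has a Gumbel limit. -/
lemma tendsto_alternating_sum {y : ℕ → ℝ} {c : ℝ}
    (h : Tendsto (fun n : ℕ => n * y n - Real.log n) atTop (𝓝 c)) (hy : ∀ᶠ n in atTop, 0 ≤ y n) :
    Tendsto (fun n : ℕ => ∑ k ∈ Finset.range (n + 1),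
      (-1) ^ k * (n.choose k : ℝ) * (max (1 - k * y n) 0) ^ n) atTop
      (𝓝 (Real.exp (-Real.exp (-c)))) := by
  have hr : Tendsto (fun n : ℕ => n * Real.exp (-(n * y n))) atTop (𝓝 (Real.exp (-c))) := by
    refine ((Real.continuous_exp.tendsto _).comp h.neg).congr' ?_
    filter_upwards [eventually_gt_atTop 0] with n hn
    have : (0 : ℝ) < n := by exact_mod_cast hn
    simp only [Function.comp_apply]
    rw [neg_sub, sub_eq_add_neg, Real.exp_add, Real.exp_log this]
  set B := Real.exp (-c) + 1 with hB
  have hlim : ∑' k : ℕ, (-Real.exp (-c)) ^ k / k.factorial = Real.exp (-Real.exp (-c)) := by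
    rw [Real.exp_eq_exp_ℝ]
    exact (NormedSpace.expSeries_div_hasSum_exp _).tsum_eq
  -- Binomial coefficients vanish beyond `n`, so the sums are series over a fixed index set.
  -- Dominated convergence applies: the `k`-th term tends to `(-e^{-c})^k / k!` and is eventually
  -- bounded by `B^k / k!`, uniformly in `k`.
  have hsum : ∀ n : ℕ, ∑ k ∈ Finset.range (n + 1),
      (-1) ^ k * (n.choose k : ℝ) * (max (1 - k * y n) 0) ^ n =
      ∑' k : ℕ, (-1) ^ k * (n.choose k : ℝ) * (max (1 - k * y n) 0) ^ n := by
    intro n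
    refine (tsum_eq_sum fun k hk => ?_).symm
    rw [Nat.choose_eq_zero_of_lt (by simpa using hk)]
    simp
  simp_rw [hsum]
  rw [← hlim]
  refine tendsto_tsum_of_dominated_convergence (Real.summable_pow_div_factorial B) ?_ ?_
  · intro k
    have h1 := ((tendsto_choose_div_pow k).mul ((tendsto_posPart_pow_mul_exp h hy k).mul
      (hr.pow k))).const_mul ((-1) ^ k)
    have e1 : (-1) ^ k * (1 / (k.factorial : ℝ) * (1 * Real.exp (-c) ^ k)) =
        (-Real.exp (-c)) ^ k / k.factorial := by
      rw [neg_pow (Real.exp (-c))]; ring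
    rw [e1] at h1
    refine h1.congr' ?_
    filter_upwards [eventually_gt_atTop 0] with n hn
    have hn' : (n : ℝ) ^ k ≠ 0 := by positivity
    have e2 : Real.exp (n * (k * y n)) * Real.exp (-(n * y n)) ^ k = 1 := by
      rw [← Real.exp_nat_mul, ← Real.exp_add]
      ring_nf
      exact Real.exp_zero
    calc (-1) ^ k * ((n.choose k : ℝ) / n ^ k * ((max (1 - k * y n) 0) ^ n *
          Real.exp (n * (k * y n)) * (n * Real.exp (-(n * y n))) ^ k))
        = (-1) ^ k * (n.choose k : ℝ) * (max (1 - k * y n) 0) ^ n * ((n : ℝ) ^ k / n ^ k) *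
          (Real.exp (n * (k * y n)) * Real.exp (-(n * y n)) ^ k) := by
          rw [mul_pow]; ring
      _ = _ := by rw [e2, div_self hn', mul_one, mul_one]
  · filter_upwards [hr.eventually_le_const (lt_add_one _)] with n hn k
    rw [norm_mul, norm_mul, norm_pow, norm_neg, norm_one, one_pow, one_mul, Real.norm_natCast,
      Real.norm_of_nonneg (by positivity)]
    calc (n.choose k : ℝ) * (max (1 - k * y n) 0) ^ n
        ≤ (n : ℝ) ^ k / k.factorial * Real.exp (-(n * (k * y n))) := by
          gcongr
          · exact Nat.choose_le_pow_div k n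
          · exact posPart_pow_le_exp _ _
      _ = (n * Real.exp (-(n * y n))) ^ k / k.factorial := by
          rw [mul_pow, ← Real.exp_nat_mul]
          ring_nf
      _ ≤ B ^ k / k.factorial := by gcongr

/-! ### The statistics in terms of gaps -/

lemma M_add {n : ℕ} (x : Fin n → ℝ) (i k : ℕ) :
    M x i (i + k) = (k - n * (orderStat x (i + k) - orderStat x i)) / scale n k := by
  rw [M, scale]
  push_cast
  rw [add_sub_cancel_left]

lemma scale_pos {n k : ℕ} (hk : 1 ≤ k) (hkn : k < n) : 0 < scale n k := by
  have hn : (0 : ℝ) < n := by exact_mod_cast (by omega : 0 < n)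
  have hk0 : (0 : ℝ) < k := by exact_mod_cast hk
  have : (k : ℝ) / n < 1 := by
    rw [div_lt_one hn]
    exact_mod_cast hkn
  exact Real.sqrt_pos.2 (mul_pos hk0 (by linarith))

lemma neg_le_M_iff {n : ℕ} (x : Fin n → ℝ) {i k : ℕ} (hk : 1 ≤ k) (hkn : k < n) (L : ℝ) :
    -L ≤ M x i (i + k) ↔
      orderStat x (i + k) - orderStat x i ≤ (k + L * scale n k) / n := by
  have hn : (0 : ℝ) < n := by exact_mod_cast (by omega : 0 < n)
  rw [M_add, le_div_iff₀ (scale_pos hk hkn), le_div_iff₀ hn]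
  constructor <;> intro h <;> linarith

lemma M_le_iff {n : ℕ} (x : Fin n → ℝ) {i k : ℕ} (hk : 1 ≤ k) (hkn : k < n) (L : ℝ) :
    M x i (i + k) ≤ L ↔
      (k - L * scale n k) / n ≤ orderStat x (i + k) - orderStat x i := by
  have hn : (0 : ℝ) < n := by exact_mod_cast (by omega : 0 < n)
  rw [M_add, div_le_iff₀ (scale_pos hk hkn), div_le_iff₀ hn]
  constructor <;> intro h <;> linarith

/-- For `n ≥ 2` the index set contains `(0, 1)`; it is finite as well, so the infimum does not take
its default value. -/
lemma MminusRange_le_iff {n l : ℕ} (hn : 2 ≤ n) (hl : 1 ≤ l) (x : Fin n → ℝ) (L : ℝ) :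
    MminusRange x 1 l ≤ L ↔ ∀ i k, 1 ≤ k → k ≤ l → k < n → i + k ≤ n →
      orderStat x (i + k) - orderStat x i ≤ (k + L * scale n k) / n := by
  have hfin : {p : ℕ × ℕ | p.1 < p.2 ∧ p.2 ≤ n ∧ 1 ≤ p.2 - p.1 ∧ p.2 - p.1 ≤ l ∧
      p.2 - p.1 < n}.Finite := by
    refine Set.Finite.subset (Finset.finite_toSet (Finset.range (n + 1) ×ˢ Finset.range (n + 1))) ?_
    rintro ⟨i, j⟩ ⟨h1, h2, -⟩
    simp only [Finset.coe_product, Finset.coe_range, Set.mem_prod, Set.mem_Iio]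
    simp only at h1 h2
    omega
  rw [MminusRange, neg_le, le_csInf_iff (hfin.image _).bddBelow ⟨_, Set.mem_image_of_mem _
    (show ((0, 1) : ℕ × ℕ) ∈ _ by simp; omega)⟩, Set.forall_mem_image]
  constructor
  · intro h i k hk hkl hkn hik
    rw [← neg_le_M_iff x hk hkn]
    exact h (show ((i, i + k) : ℕ × ℕ) ∈ _ by simp; omega)
  · rintro h ⟨i, j⟩ ⟨h1, h2, h3, h4, h5⟩
    simp only at h1 h2 h3 h4 h5
    have := h i (j - i) h3 h4 h5 (by omega)
    rw [← neg_le_M_iff x h3 h5, Nat.add_sub_cancel' h1.le] at this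
    exact this

lemma Mplus_le_iff {n : ℕ} (hn : 2 ≤ n) (x : Fin n → ℝ) (L : ℝ) :
    Mplus x ≤ L ↔ ∀ i k, 1 ≤ k → k < n → i + k ≤ n →
      (k - L * scale n k) / n ≤ orderStat x (i + k) - orderStat x i := by
  have hfin : {p : ℕ × ℕ | p.1 < p.2 ∧ p.2 ≤ n ∧ 1 ≤ p.2 - p.1 ∧ p.2 - p.1 < n}.Finite := by
    refine Set.Finite.subset (Finset.finite_toSet (Finset.range (n + 1) ×ˢ Finset.range (n + 1))) ?_
    rintro ⟨i, j⟩ ⟨h1, h2, -⟩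
    simp only [Finset.coe_product, Finset.coe_range, Set.mem_prod, Set.mem_Iio]
    simp only at h1 h2
    omega
  rw [Mplus, MplusRange, csSup_le_iff (hfin.image _).bddAbove ⟨_, Set.mem_image_of_mem _
    (show ((0, 1) : ℕ × ℕ) ∈ _ by simp; omega)⟩, Set.forall_mem_image]
  constructor
  · intro h i k hk hkn hik
    rw [← M_le_iff x hk hkn]
    exact h (show ((i, i + k) : ℕ × ℕ) ∈ _ by simp; omega)
  · rintro h ⟨i, j⟩ ⟨h1, h2, h3, h5⟩
    simp only at h1 h2 h3 h5
    have := h i (j - i) h3 h5 (by omega)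
    rw [← M_le_iff x h3 h5, Nat.add_sub_cancel' h1.le] at this
    exact this

lemma measurableSet_MminusRange_le {n l : ℕ} (hn : 2 ≤ n) (hl : 1 ≤ l) (L : ℝ) :
    MeasurableSet {x : Fin n → ℝ | MminusRange x 1 l ≤ L} := by
  simp only [MminusRange_le_iff hn hl]
  have : {x : Fin n → ℝ | ∀ i k, 1 ≤ k → k ≤ l → k < n → i + k ≤ n →
      orderStat x (i + k) - orderStat x i ≤ (k + L * scale n k) / n} =
      ⋂ i : ℕ, ⋂ k : ℕ, ⋂ (_ : 1 ≤ k), ⋂ (_ : k ≤ l), ⋂ (_ : k < n), ⋂ (_ : i + k ≤ n),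
      {x : Fin n → ℝ | orderStat x (i + k) - orderStat x i ≤ (k + L * scale n k) / n} := by
    ext; simp
  rw [this]
  exact MeasurableSet.iInter fun i => MeasurableSet.iInter fun k => MeasurableSet.iInter fun _ =>
    MeasurableSet.iInter fun _ => MeasurableSet.iInter fun _ => MeasurableSet.iInter fun _ =>
    measurableSet_le ((measurable_orderStat _).sub (measurable_orderStat _)) measurable_const

lemma ae_mem_cube (n : ℕ) : ∀ᵐ x ∂unifSample n, ∀ b, x b ∈ Set.Icc (0 : ℝ) 1 := by
  have h : unifSample n = volume.restrict (Set.univ.pi fun _ => Set.Icc (0 : ℝ) 1) :=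
    (Measure.restrict_pi_pi (fun _ : Fin n => (volume : Measure ℝ)) _).symm
  rw [h]
  filter_upwards [ae_restrict_mem (MeasurableSet.univ_pi fun _ => measurableSet_Icc)] with x hx b
  exact hx b trivial

lemma setOf_MminusRange_one_one_le {n : ℕ} (hn : 2 ≤ n) (L : ℝ) :
    {x : Fin n → ℝ | MminusRange x 1 1 ≤ L} = gapsLe n ((1 + L * scale n 1) / n) := by
  ext x
  simp only [Set.mem_ofPred_eq, MminusRange_le_iff hn le_rfl, gapsLe]
  constructor
  · intro h i hi
    simpa using h i 1 le_rfl le_rfl (by omega) hi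
  · intro h i k hk hk1 _ hik
    obtain rfl : k = 1 := le_antisymm hk1 hk
    simpa using h i hik

lemma measureReal_Mminus_le {n : ℕ} (hn : 2 ≤ n) (L : ℝ) :
    (unifSample n).real {x | Mminus x ≤ L} ≤ (unifSample n).real {x | MminusRange x 1 1 ≤ L} := by
  refine measureReal_mono fun x hx => ?_
  have hx : MminusRange x 1 n ≤ L := hx
  rw [MminusRange_le_iff hn (by omega)] at hx
  rw [Set.mem_ofPred_eq, MminusRange_le_iff hn le_rfl]
  exact fun i k hk _ hkn hik => hx i k hk hkn.le hkn hik

/-- Almost every sample lies in the unit cube; there, if no single spacing is too long but `Mminus`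
is too large, a gap of at least two steps is responsible. -/
lemma measureReal_MminusRange_one_one_le {n : ℕ} (hn : 2 ≤ n) (L : ℝ) :
    (unifSample n).real {x | MminusRange x 1 1 ≤ L} ≤
      (unifSample n).real {x | Mminus x ≤ L} + (unifSample n).real (largeExcess n L) := by
  refine le_trans ?_ (measureReal_union_le _ _)
  refine ENNReal.toReal_mono (measure_ne_top _ _) (measure_mono_ae ?_)
  filter_upwards [ae_mem_cube n] with x hcube
  intro hx
  have hx : MminusRange x 1 1 ≤ L := hx
  rw [MminusRange_le_iff hn le_rfl] at hx
  by_contra hc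
  refine hc (Or.inl ?_)
  rw [Set.mem_ofPred_eq, Mminus, MminusRange_le_iff hn (by omega)]
  intro i k hk _ hkn hik
  rcases Nat.lt_or_ge 1 k with hk2 | hk2
  · by_contra hlt
    refine hc (Or.inr ?_)
    exact Set.mem_biUnion (Finset.mem_coe.2 (Finset.mem_Ico.2 ⟨hk2, hkn⟩))
      ⟨hcube, i, hik, not_le.1 hlt⟩
  · exact hx i k hk hk2 hkn hik

lemma measureReal_lt_Mplus_le {n : ℕ} (hn : 2 ≤ n) (L : ℝ) :
    (unifSample n).real {x | L < Mplus x} ≤ (unifSample n).real (smallExcess n L) := by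
  refine ENNReal.toReal_mono (measure_ne_top _ _) (measure_mono_ae ?_)
  filter_upwards [ae_mem_cube n] with x hcube
  intro hx
  have hx : L < Mplus x := hx
  rw [← not_le, Mplus_le_iff hn] at hx
  push Not at hx
  obtain ⟨i, k, hk, hkn, hik, hlt⟩ := hx
  exact Set.mem_biUnion (Finset.mem_coe.2 (Finset.mem_Ico.2 ⟨hk, hkn⟩)) ⟨hcube, i, hik, hlt⟩

/-- Since `1 - 1/n ≤ √(1 - 1/n) ≤ 1`, replacing the scale by 1 shifts the threshold by at most `log
n / n`. -/
lemma tendsto_log_mul_one_sub_scale :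
    Tendsto (fun n : ℕ => scale n 1) atTop (𝓝 1) ∧
      Tendsto (fun n : ℕ => Real.log n * (1 - scale n 1)) atTop (𝓝 0) := by
  have hinv : Tendsto (fun n : ℕ => 1 - ((n : ℝ))⁻¹) atTop (𝓝 1) := by
    simpa using (tendsto_inv_atTop_zero.comp tendsto_natCast_atTop_atTop).const_sub (1 : ℝ)
  have hbd : ∀ n : ℕ, 1 ≤ n → 1 - ((n : ℝ))⁻¹ ≤ scale n 1 ∧ scale n 1 ≤ 1 := by
    intro n hn
    have hn' : (1 : ℝ) ≤ n := by exact_mod_cast hn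
    have h1 : ((n : ℝ))⁻¹ ≤ 1 := inv_le_one_of_one_le₀ hn'
    have h0 : 0 ≤ ((n : ℝ))⁻¹ := by positivity
    rw [scale]
    simp only [Nat.cast_one, one_mul, one_div]
    refine ⟨Real.le_sqrt_of_sq_le (by nlinarith), Real.sqrt_le_one.2 (by linarith)⟩
  constructor
  · refine tendsto_of_tendsto_of_tendsto_of_le_of_le' hinv tendsto_const_nhds ?_ ?_ <;>
      filter_upwards [eventually_ge_atTop 1] with n hn
    exacts [(hbd n hn).1, (hbd n hn).2]
  · refine squeeze_zero' ?_ ?_ (tendsto_pow_log_div 1) <;>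
      filter_upwards [eventually_ge_atTop 1] with n hn
    · exact mul_nonneg (Real.log_natCast_nonneg n) (by linarith [(hbd n hn).2])
    · rw [pow_one, div_eq_mul_inv]
      exact mul_le_mul_of_nonneg_left (by linarith [(hbd n hn).1]) (Real.log_natCast_nonneg n)

lemma tendsto_MminusRange_one_one (τ : ℝ) :
    Tendsto (fun n : ℕ => (unifSample n).real {x | MminusRange x 1 1 ≤ Real.log n + τ}) atTop
      (𝓝 (Real.exp (-Real.exp (-1 - τ)))) := by
  set y : ℕ → ℝ := fun n => (1 + (Real.log n + τ) * scale n 1) / n with hy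
  have hlim : Tendsto (fun n : ℕ => n * y n - Real.log n) atTop (𝓝 (1 + τ)) := by
    have h := ((tendsto_log_mul_one_sub_scale.1.const_mul τ).const_add 1).sub
      tendsto_log_mul_one_sub_scale.2
    rw [mul_one, sub_zero] at h
    refine h.congr' ?_
    filter_upwards [eventually_gt_atTop 0] with n hn
    have : (n : ℝ) ≠ 0 := by positivity
    simp only [hy]
    field_simp
    ring
  have hy0 : ∀ᶠ n in atTop, 0 ≤ y n := by
    filter_upwards [(tendsto_atTop_add_const_right _ τ tendsto_log_natCast).eventually_ge_atTop 0]
      with n hn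
    have := scale_nonneg n 1
    positivity
  have h := tendsto_alternating_sum hlim hy0
  rw [neg_add'] at h
  refine h.congr' ?_
  filter_upwards [hy0, eventually_ge_atTop 2] with n hn hn2
  rw [setOf_MminusRange_one_one_le hn2, measureReal_gapsLe (by omega) hn]

lemma tendsto_Mminus (τ : ℝ) :
    Tendsto (fun n : ℕ => (unifSample n).real {x | Mminus x ≤ Real.log n + τ}) atTop
      (𝓝 (Real.exp (-Real.exp (-1 - τ)))) := by
  have h := (tendsto_MminusRange_one_one τ).sub (tendsto_largeExcess τ)
  rw [sub_zero] at h
  refine tendsto_of_tendsto_of_tendsto_of_le_of_le' h (tendsto_MminusRange_one_one τ) ?_ ?_ <;>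
    filter_upwards [eventually_ge_atTop 2] with n hn
  · linarith [measureReal_MminusRange_one_one_le hn (Real.log n + τ)]
  · exact measureReal_Mminus_le hn _

lemma tendsto_lt_Mplus (τ : ℝ) :
    Tendsto (fun n : ℕ => (unifSample n).real {x | Real.log n + τ < Mplus x}) atTop (𝓝 0) := by
  refine squeeze_zero' (Eventually.of_forall fun _ => measureReal_nonneg) ?_ (tendsto_smallExcess τ)
  filter_upwards [eventually_ge_atTop 2] with n hn
  exact measureReal_lt_Mplus_le hn _

/-! ### Transfer to arbitrary probability spaces -/

section Transfer

variable {Ω : Type*} [MeasurableSpace Ω] {P : Measure Ω} {n : ℕ} {U : Fin n → Ω → ℝ}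

lemma aemeasurable_of_isUniform {X : Ω → ℝ} (h : pdf.IsUniform X (Set.Icc (0 : ℝ) 1) P volume) :
    AEMeasurable X P :=
  h.aemeasurable (by simp) (by simp)

lemma map_eq_unifSample [IsProbabilityMeasure P] (hindep : iIndepFun U P)
    (hunif : ∀ i, pdf.IsUniform (U i) (Set.Icc (0 : ℝ) 1) P volume) :
    P.map (fun ω i => U i ω) = unifSample n := by
  rw [(iIndepFun_iff_map_fun_eq_pi_map fun i => aemeasurable_of_isUniform (hunif i)).1 hindep,
    unifSample]
  congr 1
  ext1 i
  rw [hunif i, ProbabilityTheory.cond, unif]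
  simp

lemma measureReal_sample_eq [IsProbabilityMeasure P] (hindep : iIndepFun U P)
    (hunif : ∀ i, pdf.IsUniform (U i) (Set.Icc (0 : ℝ) 1) P volume) {S : Set (Fin n → ℝ)}
    (hS : MeasurableSet S) :
    P.real {ω | (fun i => U i ω) ∈ S} = (unifSample n).real S := by
  rw [← map_eq_unifSample hindep hunif, measureReal_def, measureReal_def,
    Measure.map_apply_of_aemeasurable
      (aemeasurable_pi_lambda _ fun i => aemeasurable_of_isUniform (hunif i)) hS]
  rfl

/-- This inequality holds for outer measure, so measurability of the event for `Mplus` is not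
needed. -/
lemma measureReal_sample_le [IsProbabilityMeasure P] (hindep : iIndepFun U P)
    (hunif : ∀ i, pdf.IsUniform (U i) (Set.Icc (0 : ℝ) 1) P volume) (S : Set (Fin n → ℝ)) :
    P.real {ω | (fun i => U i ω) ∈ S} ≤ (unifSample n).real S := by
  refine ENNReal.toReal_mono (measure_ne_top _ _) ?_
  rw [← map_eq_unifSample hindep hunif]
  exact Measure.le_map_apply
    (aemeasurable_pi_lambda _ fun i => aemeasurable_of_isUniform (hunif i)) S

end Transfer

end ScanStat

/-! ### The limit theorem -/

open ScanStat in
theorem theorem2 {Ω : ℕ → Type*} [∀ n, MeasurableSpace (Ω n)]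
    (P : ∀ n, Measure (Ω n)) [∀ n, IsProbabilityMeasure (P n)]
    (U : ∀ n, Fin n → Ω n → ℝ)
    (hindep : ∀ n, iIndepFun (U n) (P n))
    (hunif : ∀ n i, pdf.IsUniform (U n i) (Set.Icc (0 : ℝ) 1) (P n) volume) :
    (∀ τ : ℝ,
      Tendsto (fun n : ℕ =>
          (P n).real {ω | ScanStat.Mminus (fun i => U n i ω) ≤ Real.log n + τ})
        atTop (𝓝 (Real.exp (-Real.exp (-1 - τ))))) ∧
    (∀ τ : ℝ,
      Tendsto (fun n : ℕ =>
          (P n).real {ω | ScanStat.MminusRange (fun i => U n i ω) 1 1 ≤ Real.log n + τ})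
        atTop (𝓝 (Real.exp (-Real.exp (-1 - τ))))) ∧
    Tendsto (fun n : ℕ =>
        (P n).real {ω | ScanStat.Mtwo (fun i => U n i ω) = ScanStat.Mminus (fun i => U n i ω)})
      atTop (𝓝 1) := by
  have hMminus : ∀ τ : ℝ, Tendsto (fun n : ℕ =>
      (P n).real {ω | Mminus (fun i => U n i ω) ≤ Real.log n + τ})
      atTop (𝓝 (Real.exp (-Real.exp (-1 - τ)))) := by
    intro τ
    refine (tendsto_Mminus τ).congr' ?_
    filter_upwards [eventually_ge_atTop 2] with n hn
    exact (measureReal_sample_eq (hindep n) (hunif n)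
      (measurableSet_MminusRange_le hn (by omega) _)).symm
  refine ⟨hMminus, fun τ => ?_, ?_⟩
  · refine (tendsto_MminusRange_one_one τ).congr' ?_
    filter_upwards [eventually_ge_atTop 2] with n hn
    exact (measureReal_sample_eq (hindep n) (hunif n)
      (measurableSet_MminusRange_le hn le_rfl _)).symm
  · have hcover : ∀ (τ : ℝ) (n : ℕ),
        1 ≤ (P n).real {ω | Mtwo (fun i => U n i ω) = Mminus (fun i => U n i ω)} +
          ((unifSample n).real {x | Real.log n + τ < Mplus x} +
            (P n).real {ω | Mminus (fun i => U n i ω) ≤ Real.log n + τ}) := by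
      intro τ n
      rw [← probReal_univ (μ := P n)]
      have hsub : (Set.univ : Set (Ω n)) ⊆
          {ω | Mtwo (fun i => U n i ω) = Mminus (fun i => U n i ω)} ∪
          ({ω | (fun i => U n i ω) ∈ {x | Real.log n + τ < Mplus x}} ∪
            {ω | Mminus (fun i => U n i ω) ≤ Real.log n + τ}) := by
        intro ω _
        by_cases h1 : Mplus (fun i => U n i ω) ≤ Mminus (fun i => U n i ω)
        · exact Or.inl (max_eq_right h1)
        · by_cases h2 : Mminus (fun i => U n i ω) ≤ Real.log n + τ
          · exact Or.inr (Or.inr h2)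
          · exact Or.inr (Or.inl ((not_le.1 h2).trans (not_le.1 h1)))
      refine (measureReal_mono hsub).trans ((measureReal_union_le _ _).trans ?_)
      refine add_le_add le_rfl ((measureReal_union_le _ _).trans ?_)
      exact add_le_add (measureReal_sample_le (hindep n) (hunif n) _) le_rfl
    -- The level `τ` is sent to `-∞` only after `n → ∞`: for each `a < 1`, one fixed, very negative
    -- `τ` makes the limiting lower bound exceed `a`.
    have hsmall : Tendsto (fun τ : ℝ => 1 - Real.exp (-Real.exp (-1 - τ))) atBot (𝓝 1) := by
      have h1 : Tendsto (fun τ : ℝ => -Real.exp (-1 - τ)) atBot atBot := by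
        refine tendsto_neg_atTop_atBot.comp (Real.tendsto_exp_atTop.comp ?_)
        exact tendsto_atTop_add_const_left _ (-1) tendsto_neg_atBot_atTop
      simpa using (Real.tendsto_exp_atBot.comp h1).const_sub 1
    refine tendsto_order.2 ⟨fun a ha => ?_, fun a ha => Eventually.of_forall fun n =>
      measureReal_le_one.trans_lt ha⟩
    obtain ⟨τ, hτ⟩ := (hsmall.eventually_const_lt ha).exists
    have hlim := ((tendsto_lt_Mplus τ).add (hMminus τ)).const_sub 1
    rw [zero_add] at hlim
    filter_upwards [hlim.eventually_const_lt hτ] with n hn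
    linarith [hcover τ n]
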